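/- **Model.** There are $S$ stations. For each unordered pair $\{i,j\}$ of distinct stations let $p_{ij}\ge 0$ be the probability that $i,j$ are the two stations closest to an EV in need of charging, $\sum_{\{i,j\}}p_{ij}=1$ (so $S\ge 2$); put $p_i=\tfrac12\sum_{j\ne i}p_{ij}$ and $E=\{\{i,j\}:p_{ij}>0\}$, and assume that the graph $(\{1,\dots,S\},E)$ is connected. Let $\lambda,\mu>0$ and $\gamma\le\beta$ be real. The system with $r$ cars has $B_i^r\in\mathbb N$ spare batteries and $F_i^r\in\mathbb N$ charging points at station $i$, where $B_i^r$ and $F_i^r$ equal $p_i\big(\frac{\lambda r}{\mu}+\beta\sqrt{\lambda r/\mu}\big)$ and $p_i\big(\frac{\lambda r}{\mu}+\gamma\sqrt{\lambda r/\mu}\big)$ up to rounding (that is, each differs by at most $1$ from the positive part of the respective expression). On a probability space let $\Lambda_{ij}$ ($\{i,j\}\in E$) and $S_j$ ($1\le j\le S$) be independent Poisson processes with rates $p_{ij}\lambda$ and $\mu$. For each $r$ let $\mathbb X^r=(A^r,A^r_d,Q^r,Z^r,Y^r,T^r,D^r,L^r)$ be a stochastic process with right-continuous paths with left limits, such that $A^r_{ij}$,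 $A^r_{ij,i}$ and $D^r_j$ are $\mathbb N$-valued and nondecreasing, $Q^r_j$ and $L^r$ are $\mathbb N$-valued, and for all $t\ge0$, $\{i,j\}\in E$ and $1\le j\le S$ $$A_{ij}^r=A_{ij,i}^r+A_{ij,j}^r,\quad A^r_{ij}(t)=\Lambda_{ij}(Y^r(t)),\quad Q^r_j(t)=Q^r_j(0)+\sum_{i:\{i,j\}\in E}A^r_{ij,j}(t)-D^r_j(t),\quad D^r_j(t)=S_j(T^r_j(t)),$$ $$Y^r(t)=\int_0^tL^r(s)\,ds,\quad T^r_j(t)=\int_0^tZ^r_j(s)\,ds,\quad Z^r_j=\min\{Q^r_j,F^r_j\},\quad L^r=r-\sum_{j}(Q^r_j-B^r_j)^+,$$ and arrivals are routed to the relatively least-loaded station: if $Q^r_i(u)/p_i>Q^r_j(u)/p_j$ for all $u\in[s,t)$, then $A^r_{ij,i}(t)=A^r_{ij,i}(s)$. Let $\mathcal A$ be the set of $\omega$ for which $\Lambda_{ij}(rx)/r\to p_{ij}\lambda x$ and $S_j(rx)/r\to\mu x$ uniformly on compact sets of $x\ge 0$ (u.o.c.) as $r\to\infty$, for all $\{i,j\}\in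 E$ and all $j$. A *fluid limit* of $\{\mathbb X^r\}$ is a path $\bar{\mathbb X}=(\bar A,\bar A_d,\bar Q,\bar Z,\bar Y,\bar T,\bar D,\bar L)$ such that for some $\omega\in\mathcal A$ and some $r_l\to\infty$, $\mathbb X^{r_l}(\cdot,\omega)/r_l\to\bar{\mathbb X}$ u.o.c. A vector $q\in\mathbb R^S$ is an *invariant state* if each fluid limit with $\bar Q(0)=q$ satisfies $\bar Q(t)=q$ for all $t\ge0$. **Theorem.** (a) Fluid limits exist: $\mathbb P(\mathcal A)=1$, and for each $\omega\in\mathcal A$ each sequence $r_l\to\infty$ has a subsequence along which $\mathbb X^{r}(\cdot,\omega)/r$ converges u.o.c. Each component of each fluid limit is Lipschitz continuous on $[0,\infty)$. (b) Each fluid limit satisfies, for all $t\ge0$, $\{i,j\}\in E$ and $1\le j\le S$, $$\bar A_{ij}=\bar A_{ij,i}+\bar A_{ij,j},\quad \bar A_{ij}(t)=p_{ij}\lambda\bar Y(t),\quad \bar Q_j(t)=\bar Q_j(0)+\sum_{i:\{i,j\}\in E}\bar A_{ij,j}(t)-\bar D_j(t),\quad \bar D_j(t)=\mu\bar T_j(t),$$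 $$\bar Y(t)=\int_0^t\bar L(s)\,ds,\quad \bar T_j(t)=\int_0^t\bar Z_j(s)\,ds,\quad \bar Z_j=\min\{\bar Q_j,p_j\lambda/\mu\},\quad \bar L=1-\sum_j(\bar Q_j-p_j\lambda/\mu)^+ .$$ (c) If every component of a fluid limit $\bar{\mathbb X}$ is differentiable at $t\ge0$ (one-sidedly if $t=0$), then for each pair of stations with $\{i,j\}\in E$ $$\bar A'_{ij,i}(t)=\lambda p_{ij}\bar L(t)\quad\text{and}\quad\bar A'_{ij,j}(t)=0\qquad\text{if }\ \frac{\bar Q_j(t)}{p_j}>\frac{\bar Q_i(t)}{p_i}.$$ (d) $q=(p_1\lambda/\mu,\dots,p_S\lambda/\mu)$ is an invariant state, and it is the only one among the vectors that occur as $\bar Q(0)$ for some fluid limit $\bar{\mathbb X}$ of $\{\mathbb X^r\}$. -/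

import Mathlib

open MeasureTheory ProbabilityTheory Filter Topology Set
open scoped NNReal

/-- The parameters of a network of `S` battery swapping stations. `p s(i, j)` is the probability
that `i` and `j` are the two stations in the direct vicinity of an EV that needs recharging,
`lam` is the rate at which a driving EV comes to need recharging, `mu` is the charging rate,
and `beta`, `gamma` are the coefficients of the square-root capacity rule. -/
structure SwapNetwork (S : ℕ) where
  p : Sym2 (Fin S) → ℝ
  p_nonneg : ∀ e, 0 ≤ p e
  p_diag : ∀ i, p s(i, i) = 0
  p_sum : ∑ e, p e = 1
  lam : ℝ
  mu : ℝ
  beta : ℝ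
  gamma : ℝ
  lam_pos : 0 < lam
  mu_pos : 0 < mu
  gamma_le_beta : gamma ≤ beta

namespace SwapNetwork

variable {S : ℕ} (N : SwapNetwork S)

/-- The graph whose edges are the pairs `{i, j}` with `p_{ij} > 0`. -/
def graph : SimpleGraph (Fin S) where
  Adj i j := 0 < N.p s(i, j)
  symm := ⟨fun i j h => by rwa [Sym2.eq_swap]⟩
  loopless := ⟨fun i h => by rw [N.p_diag i] at h; exact lt_irrefl _ h⟩

/-- The effective arrival probability `p_i = ∑_j p_{ij} / 2` of station `i`. -/
noncomputable def effProb (i : Fin S) : ℝ := ∑ j, N.p s(i, j) / 2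

/-- The nominal (real-valued) capacity `p_i (λ r / μ + c √(λ r / μ))` of station `i` in the system
with `r` cars. -/
noncomputable def nominalCapacity (c : ℝ) (r : ℕ) (i : Fin S) : ℝ :=
  N.effProb i * (N.lam * r / N.mu + c * Real.sqrt (N.lam * r / N.mu))

/-- `C r i` (a number of charging points or of spare batteries) is the nominal capacity, rounded to
a neighbouring natural number in any way (and rounded up to about `0` if the nominal capacity is
negative, which can happen for small `r` when `c < 0`). -/
def IsRoundedCapacity (c : ℝ) (C : ℕ → Fin S → ℕ) : Prop :=
  ∀ r i, |(C r i : ℝ) - max (N.nominalCapacity c r i) 0| ≤ 1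

/-- The (names of the) components of the network process `(A, A_d, Q, Z, Y, T, D, L)`. -/
inductive Comp
  /-- `A_{ij}`: number of arrivals that are closest to the two stations of the edge. -/
  | arr (e : N.graph.edgeSet)
  /-- `A_{ij,i}`: number of arrivals closest to `i` and `j` that are routed to `i`. -/
  | routed (i j : Fin S) (h : N.graph.Adj i j)
  /-- `Q_j`: number of batteries in need of charging at station `j`. -/
  | queue (j : Fin S)
  /-- `Z_j`: number of busy charging points at station `j`. -/
  | busy (j : Fin S)
  /-- `Y`: aggregated time of all cars that are not waiting at a station. -/
  | driveTime
  /-- `T_j`: aggregated charging time of all charging points of station `j`. -/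
  | busyTime (j : Fin S)
  /-- `D_j`: number of service completions at station `j`. -/
  | compl (j : Fin S)
  /-- `L`: number of batteries positioned in an EV that is not waiting at a station. -/
  | driving

/-- A (deterministic) path of the network process; only times `t ≥ 0` are relevant. -/
abbrev Path : Type := N.Comp → ℝ → ℝ

end SwapNetwork

/-- `f` is right-continuous with left limits on `[0, ∞)`. -/
def IsCadlagPath (f : ℝ → ℝ) : Prop :=
  (∀ t, 0 ≤ t → ContinuousWithinAt f (Ici t) t) ∧
    ∀ t, 0 < t → ∃ l, Tendsto f (𝓝[<] t) (𝓝 l)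

/-- `f` is a natural number at each time `t ≥ 0`. -/
def IsNatValuedPath (f : ℝ → ℝ) : Prop := ∀ t, 0 ≤ t → ∃ n : ℕ, f t = n

/-- `f` counts events: it takes values in the natural numbers and is nondecreasing. -/
def IsCountingPath (f : ℝ → ℝ) : Prop := IsNatValuedPath f ∧ MonotoneOn f (Ici 0)

/-- A Poisson process with rate `rate` on a probability space. -/
structure IsPoissonProc {Ω : Type*} [MeasurableSpace Ω] (M : ℝ≥0 → Ω → ℕ) (rate : ℝ≥0)
    (P : Measure Ω) : Prop where
  measurable : ∀ t, Measurable (M t)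
  zero : ∀ ω, M 0 ω = 0
  mono : ∀ ω, Monotone fun t => M t ω
  rightCont : ∀ ω t, ContinuousWithinAt (fun s => M s ω) (Ici t) t
  indepIncr : HasIndepIncrements M P
  law : ∀ s t, s ≤ t →
    P.map (fun ω => M t ω - M s ω) = poissonMeasure (rate * (t - s))

namespace SwapNetwork

variable {S : ℕ} (N : SwapNetwork S)

/-- The driving processes: independent Poisson processes `Λ_{ij}` of rate `p_{ij} λ`, one for each
edge, and `V_j` of rate `μ`, one for each station. -/
structure IsPrimitive {Ω : Type*} [MeasurableSpace Ω] (P : Measure Ω)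
    (Lam : N.graph.edgeSet → ℝ≥0 → Ω → ℕ) (V : Fin S → ℝ≥0 → Ω → ℕ) : Prop where
  arrivals : ∀ e, IsPoissonProc (Lam e) (N.p e * N.lam).toNNReal P
  services : ∀ j, IsPoissonProc (V j) N.mu.toNNReal P
  indep : iIndepFun
    (fun (k : N.graph.edgeSet ⊕ Fin S) (ω : Ω) (t : ℝ≥0) => Sum.elim Lam V k t ω) P

open SwapNetwork.Comp in
open scoped Classical in
/-- The system identities for one path `x` of the system with `r` cars, where `Lam` and `V` are the
paths of the driving processes, and `B j`, `F j` are the numbers of spare batteries and of charging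
points of station `j`. -/
structure IsSystemPath (r : ℕ) (B F : Fin S → ℕ) (Lam : N.graph.edgeSet → ℝ≥0 → ℕ)
    (V : Fin S → ℝ≥0 → ℕ) (x : N.Path) : Prop where
  cadlag : ∀ c, IsCadlagPath (x c)
  arr_counting : ∀ e, IsCountingPath (x (arr e))
  routed_counting : ∀ i j h, IsCountingPath (x (routed i j h))
  compl_counting : ∀ j, IsCountingPath (x (compl j))
  queue_nat : ∀ j, IsNatValuedPath (x (queue j))
  driving_nat : IsNatValuedPath (x driving)
  arr_split : ∀ i j (h : N.graph.Adj i j) t, 0 ≤ t →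
    x (arr ⟨s(i, j), h⟩) t = x (routed i j h) t + x (routed j i h.symm) t
  arr_eq : ∀ e t, 0 ≤ t → x (arr e) t = Lam e (x driveTime t).toNNReal
  queue_eq : ∀ j t, 0 ≤ t →
    x (queue j) t =
      x (queue j) 0 + ∑ i : N.graph.neighborSet j, x (routed j i i.2) t - x (compl j) t
  compl_eq : ∀ j t, 0 ≤ t → x (compl j) t = V j (x (busyTime j) t).toNNReal
  driveTime_eq : ∀ t, 0 ≤ t → x driveTime t = ∫ s in (0 : ℝ)..t, x driving s
  busyTime_eq : ∀ j t, 0 ≤ t → x (busyTime j) t = ∫ s in (0 : ℝ)..t, x (busy j) s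
  busy_eq : ∀ j t, 0 ≤ t → x (busy j) t = min (x (queue j) t) (F j)
  driving_eq : ∀ t, 0 ≤ t → x driving t = r - ∑ j, max (x (queue j) t - B j) 0
  /-- `A_{ij,i}` can only increase when `Q_i / p_i ≤ Q_j / p_j`. The decision at an arrival epoch is
  based on the state just before it, so the window `[s, t)` excludes `t` while an arrival
  at time `t` itself is covered by the conclusion. -/
  routing : ∀ i j (h : N.graph.Adj i j) s t, 0 ≤ s → s < t →
    (∀ u ∈ Ico s t, x (queue j) u / N.effProb j < x (queue i) u / N.effProb i) →
    x (routed i j h) t = x (routed i j h) s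

/-- `X r` is, for each number of cars `r`, a stochastic process whose paths satisfy the system
identities. -/
structure IsSystemSequence {Ω : Type*} [MeasurableSpace Ω] (B F : ℕ → Fin S → ℕ)
    (Lam : N.graph.edgeSet → ℝ≥0 → Ω → ℕ) (V : Fin S → ℝ≥0 → Ω → ℕ)
    (X : ℕ → Ω → N.Path) : Prop where
  measurable : ∀ r c t, 0 ≤ t → Measurable fun ω => X r ω c t
  path : ∀ r ω, N.IsSystemPath r (B r) (F r) (fun e t => Lam e t ω) (fun j t => V j t ω) (X r ω)

/-- The set `𝒜` of sample points at which the functional strong law of large numbers holds for the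
driving processes, uniformly on compact sets. -/
def fsllnSet {Ω : Type*} (Lam : N.graph.edgeSet → ℝ≥0 → Ω → ℕ) (V : Fin S → ℝ≥0 → Ω → ℕ) :
    Set Ω :=
  {ω | (∀ e (T : ℝ), TendstoUniformlyOn
          (fun (r : ℕ) (x : ℝ) => (Lam e (r * x).toNNReal ω : ℝ) / r)
          (fun x => N.p e * N.lam * x) atTop (Icc 0 T)) ∧
       (∀ j (T : ℝ), TendstoUniformlyOn
          (fun (r : ℕ) (x : ℝ) => (V j (r * x).toNNReal ω : ℝ) / r)
          (fun x => N.mu * x) atTop (Icc 0 T))}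

/-- Along the sequence `rl` the fluid-scaled paths `X^r(·, ω) / r` converge to `x`, uniformly on
compact sets. -/
def FluidConverges {Ω : Type*} (X : ℕ → Ω → N.Path) (ω : Ω) (rl : ℕ → ℕ) (x : N.Path) : Prop :=
  ∀ c (T : ℝ), TendstoUniformlyOn (fun l t => X (rl l) ω c t / rl l) (x c) atTop (Icc 0 T)

/-- `x` is a fluid limit of the sequence of systems `X`. -/
def IsFluidLimit {Ω : Type*} (Lam : N.graph.edgeSet → ℝ≥0 → Ω → ℕ) (V : Fin S → ℝ≥0 → Ω → ℕ)
    (X : ℕ → Ω → N.Path) (x : N.Path) : Prop :=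
  ∃ ω ∈ N.fsllnSet Lam V, ∃ rl : ℕ → ℕ, Tendsto rl atTop atTop ∧ N.FluidConverges X ω rl x

/-- `q` is an invariant state of the fluid limits of `X`: a fluid limit whose queue length vector
starts in `q` stays in `q`. -/
def IsInvariantState {Ω : Type*} (Lam : N.graph.edgeSet → ℝ≥0 → Ω → ℕ)
    (V : Fin S → ℝ≥0 → Ω → ℕ) (X : ℕ → Ω → N.Path) (q : Fin S → ℝ) : Prop :=
  ∀ x, N.IsFluidLimit Lam V X x → (∀ i, x (.queue i) 0 = q i) →
    ∀ t, 0 ≤ t → ∀ i, x (.queue i) t = q i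

open SwapNetwork.Comp in
open scoped Classical in
/-- The fluid equations. -/
structure FluidEquations (x : N.Path) : Prop where
  arr_split : ∀ i j (h : N.graph.Adj i j) t, 0 ≤ t →
    x (arr ⟨s(i, j), h⟩) t = x (routed i j h) t + x (routed j i h.symm) t
  arr_eq : ∀ e t, 0 ≤ t → x (arr e) t = N.p e * N.lam * x driveTime t
  queue_eq : ∀ j t, 0 ≤ t →
    x (queue j) t =
      x (queue j) 0 + ∑ i : N.graph.neighborSet j, x (routed j i i.2) t - x (compl j) t
  compl_eq : ∀ j t, 0 ≤ t → x (compl j) t = N.mu * x (busyTime j) t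
  driveTime_eq : ∀ t, 0 ≤ t → x driveTime t = ∫ s in (0 : ℝ)..t, x driving s
  busyTime_eq : ∀ j t, 0 ≤ t → x (busyTime j) t = ∫ s in (0 : ℝ)..t, x (busy j) s
  busy_eq : ∀ j t, 0 ≤ t → x (busy j) t = min (x (queue j) t) (N.effProb j * N.lam / N.mu)
  driving_eq : ∀ t, 0 ≤ t →
    x driving t = 1 - ∑ j, max (x (queue j) t - N.effProb j * N.lam / N.mu) 0

/-- `t ≥ 0` is a regular point of `x`: every component is differentiable at `t` as a function on
`[0, ∞)` (so one-sided at `t = 0`). -/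
def IsRegularPoint (x : N.Path) (t : ℝ) : Prop :=
  0 ≤ t ∧ ∀ c, DifferentiableWithinAt ℝ (x c) (Ici 0) t

end SwapNetwork

/-!
The fluid limits of the battery swapping network are analysed path by path; probability enters only
through the functional law of large numbers for the Poisson processes that drive the network. That
law follows from the strong law for the integer increments (`IsPoissonProc.ae_tendsto_div_natCast`),
because a monotone function is controlled by its values at the integers.

*Existence.* The driving time and the busy times are integrals of bounded rates, so their scaled
versions are Lipschitz. A counting process that is a random time change of a Poisson process is
then Lipschitz up to an error that vanishes (`AsympLipschitz.time_change`), and this property passes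
to the routed streams, which are dominated by the stream they split, and to the queue lengths, busy
points and driving cars. Initial values are bounded since at most `r` cars wait. A version of the
Arzelà–Ascoli theorem for such asymptotically Lipschitz sequences
(`AsympLipschitz.exists_subseq_tendstoUniformlyOn`) yields convergent subsequences with Lipschitz
limits, and the system identities pass to the limit (`IsScalingSequence.fluidEquations`).

*Routing.* If in the limit station `j` is relatively more loaded than `i` at time `t`, then by
continuity and uniform convergence the same holds near `t` in all large systems, so that `A_{ij,j}`
is constant near `t` (`IsScalingSequence.eventually_routed_eq`).

*Invariant state.* Write `u_j = Q_j / p_j` and let `w_j = g(u_j(t))` for an increasing function `g`.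
Although a single queue length need not be differentiable when loads are tied, the sum
`∑ w_j Q_j` with these weights frozen is differentiable at `t`: on each edge all arrivals count
with the smaller of the two weights. Its derivative is
`λ L ∑_{ij} p_{ij} min(w_i, w_j) - μ ∑ w_j Z_j`, and `∑_{ij} p_{ij} min(w_i, w_j) ≤ ∑ p_j w_j`.
Hence, for `ρ = λ / μ`, both `∑ p_j ((u_j - ρ)⁺)²` and, once this vanishes and therefore `L = 1`,
`∑ p_j ((ρ - u_j)⁺)²` are everywhere differentiable with nonpositive derivative; if they vanish at
time `0`, they vanish forever. Conversely, for constant queue lengths the derivative is `0`. With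
`w_j = (u_j - ρ)⁺` this excludes overloaded stations, since these would force `L < 1`; then
`w_j = 1` gives `∑ Q_j = ρ`, which is only possible if `Q_j = p_j ρ` for all `j`.
-/

/-! ### The functional law of large numbers for Poisson processes -/

/-- The series for the mean of the Poisson distribution with rate `r`. -/
theorem hasSum_poisson_mean (r : ℝ≥0) :
    HasSum (fun n : ℕ => Real.exp (-r) * (r : ℝ) ^ n / (n.factorial : ℝ) * (n : ℝ)) r := by
  rw [← hasSum_nat_add_iff' 1]
  have h := (hasSum_one_poissonMeasure r).mul_left (r : ℝ)
  simp only [Finset.range_one, Finset.sum_singleton, Nat.cast_zero, mul_zero, sub_zero]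
  rw [mul_one] at h
  refine h.congr_fun fun n => ?_
  have : ((n.factorial : ℕ) : ℝ) ≠ 0 := by positivity
  rw [Nat.factorial_succ]
  push_cast
  field_simp
  ring

theorem integrable_natCast_poissonMeasure (r : ℝ≥0) :
    Integrable (fun n : ℕ => (n : ℝ)) (poissonMeasure r) := by
  rw [integrable_poissonMeasure_iff]
  simpa using (hasSum_poisson_mean r).summable

theorem integral_natCast_poissonMeasure (r : ℝ≥0) :
    ∫ n : ℕ, (n : ℝ) ∂(poissonMeasure r) = r := by
  rw [integral_poissonMeasure]
  simpa only [smul_eq_mul] using (hasSum_poisson_mean r).tsum_eq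

namespace IsPoissonProc

variable {Ω : Type*} [MeasurableSpace Ω] {P : Measure Ω} {M : ℝ≥0 → Ω → ℕ} {rate : ℝ≥0}

theorem ae_tendsto_div_natCast (hM : IsPoissonProc M rate P) :
    ∀ᵐ ω ∂P, Tendsto (fun n : ℕ => (M n ω : ℝ) / n) atTop (𝓝 rate) := by
  set I : ℕ → Ω → ℕ := fun n ω => M ((n + 1 : ℕ) : ℝ≥0) ω - M (n : ℝ≥0) ω with hI
  have hmeas : ∀ n, Measurable (I n) := fun n => (hM.measurable _).sub (hM.measurable _)
  have hcast : Measurable (fun n : ℕ => (n : ℝ)) := measurable_of_countable _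
  have hlaw : ∀ n, P.map (I n) = poissonMeasure rate := by
    intro n
    have h := hM.law (n : ℝ≥0) ((n + 1 : ℕ) : ℝ≥0) (by exact_mod_cast Nat.le_succ n)
    rw [h]
    congr 1
    push_cast
    simp
  have hindep : iIndepFun I P :=
    hM.indepIncr.nat (t := fun n : ℕ => (n : ℝ≥0)) Nat.mono_cast
  have hint : Integrable (fun ω => (I 0 ω : ℝ)) P := by
    have h := integrable_natCast_poissonMeasure rate
    rw [← hlaw 0] at h
    exact h.comp_measurable (hmeas 0)
  have hmean : ∫ ω, (I 0 ω : ℝ) ∂P = rate := by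
    rw [← integral_natCast_poissonMeasure rate, ← hlaw 0,
      integral_map (hmeas 0).aemeasurable hcast.aestronglyMeasurable]
  have hslln := strong_law_ae_real (μ := P) (fun n ω => (I n ω : ℝ)) hint
    (fun i j hij => (hindep.indepFun hij).comp hcast hcast)
    (fun i => (IdentDistrib.mk (hmeas i).aemeasurable (hmeas 0).aemeasurable
      ((hlaw i).trans (hlaw 0).symm)).comp hcast)
  rw [hmean] at hslln
  filter_upwards [hslln] with ω hω
  refine hω.congr fun n => ?_
  have hsum : ∀ n : ℕ, ∑ i ∈ Finset.range n, (I i ω : ℝ) = M n ω := by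
    intro n
    induction n with
    | zero => simp [hM.zero ω]
    | succ k ih =>
      have hle : M (k : ℝ≥0) ω ≤ M ((k + 1 : ℕ) : ℝ≥0) ω :=
        hM.mono ω (by exact_mod_cast Nat.le_succ k)
      rw [Finset.sum_range_succ, ih, hI]
      simp only
      rw [Nat.cast_sub hle]
      ring
  rw [hsum]

end IsPoissonProc

/-- A monotone counting function that grows linearly along the integers stays within sublinear
distance of a line. -/
theorem exists_abs_sub_le_of_tendsto_div {f : ℝ≥0 → ℕ} (hf : Monotone f) {a : ℝ} (ha : 0 ≤ a)
    (h : Tendsto (fun n : ℕ => (f n : ℝ) / n) atTop (𝓝 a)) {η : ℝ} (hη : 0 < η) :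
    ∃ C : ℝ, 0 ≤ C ∧ ∀ t : ℝ≥0, |(f t : ℝ) - a * t| ≤ η * t + C := by
  obtain ⟨n₀, hn₀⟩ := (Metric.tendsto_atTop.1 h) η hη
  set C₀ : ℝ := ∑ k ∈ Finset.range (n₀ + 1), |(f k : ℝ) - a * k| with hC₀
  have hC₀n : 0 ≤ C₀ := Finset.sum_nonneg fun _ _ => abs_nonneg _
  have hnat : ∀ n : ℕ, |(f n : ℝ) - a * n| ≤ η * n + C₀ := by
    intro n
    by_cases hn : n ≤ n₀
    · have : |(f n : ℝ) - a * n| ≤ C₀ :=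
        Finset.single_le_sum (f := fun k : ℕ => |(f k : ℝ) - a * k|) (fun _ _ => abs_nonneg _)
          (Finset.mem_range.2 (by omega))
      have : 0 ≤ η * n := by positivity
      linarith
    · have hn' : n₀ ≤ n := by omega
      have hpos : (0 : ℝ) < n := by exact_mod_cast (by omega : 0 < n)
      have h1 := hn₀ n hn'
      rw [Real.dist_eq] at h1
      have h2 : (f n : ℝ) - a * n = ((f n : ℝ) / n - a) * n := by field_simp
      rw [h2, abs_mul, abs_of_pos hpos]
      nlinarith
  refine ⟨a + η + C₀, by positivity, fun t => ?_⟩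
  set n := ⌊t⌋₊ with hn
  have h1 : (n : ℝ≥0) ≤ t := Nat.floor_le t.2
  have h2 : t ≤ ((n + 1 : ℕ) : ℝ≥0) := by
    push_cast
    exact (Nat.lt_floor_add_one t).le
  have h1' : (n : ℝ) ≤ t := by exact_mod_cast h1
  have h2' : (t : ℝ) ≤ n + 1 := by exact_mod_cast h2
  have hl : (f n : ℝ) ≤ f t := by exact_mod_cast hf h1
  have hu : (f t : ℝ) ≤ f ((n + 1 : ℕ) : ℝ≥0) := by exact_mod_cast hf h2
  have e1 := abs_le.1 (hnat n)
  have e2 := abs_le.1 (hnat (n + 1))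
  push_cast at e2 hu
  rw [abs_le]
  constructor <;> nlinarith

/-- A law of large numbers along the integers implies its functional version, uniformly on compact
sets. -/
theorem tendstoUniformlyOn_scaled_of_tendsto_div {f : ℝ≥0 → ℕ} (hf : Monotone f) {a : ℝ}
    (ha : 0 ≤ a) (h : Tendsto (fun n : ℕ => (f n : ℝ) / n) atTop (𝓝 a)) (T : ℝ) :
    TendstoUniformlyOn (fun (r : ℕ) (x : ℝ) => (f (r * x).toNNReal : ℝ) / r)
      (fun x => a * x) atTop (Icc 0 T) := by
  rw [Metric.tendstoUniformlyOn_iff]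
  intro ε hε
  obtain ⟨C, hC, hfC⟩ := exists_abs_sub_le_of_tendsto_div hf ha h
    (η := ε / (2 * (|T| + 1))) (by positivity)
  obtain ⟨n₀, hn₀⟩ := exists_nat_gt (2 * C / ε)
  filter_upwards [eventually_gt_atTop n₀] with r hr x hx
  have hr' : (n₀ : ℝ) < r := by exact_mod_cast hr
  have hr0 : (0 : ℝ) < r := lt_of_le_of_lt (Nat.cast_nonneg _) hr'
  have hrx : 0 ≤ (r : ℝ) * x := mul_nonneg hr0.le hx.1
  have h1 := hfC (r * x).toNNReal
  rw [Real.coe_toNNReal _ hrx] at h1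
  have h2 : (f (r * x).toNNReal : ℝ) / r - a * x
      = ((f (r * x).toNNReal : ℝ) - a * (r * x)) / r := by field_simp
  rw [dist_comm, Real.dist_eq, h2, abs_div, abs_of_pos hr0, div_lt_iff₀ hr0]
  have h3 : 2 * C < ε * r := by
    rw [div_lt_iff₀ hε] at hn₀
    nlinarith
  have h4 : ε / (2 * (|T| + 1)) * (r * x) ≤ ε / 2 * r := by
    have hxT : x ≤ |T| + 1 := by linarith [hx.2, le_abs_self T]
    have hT : 0 < |T| + 1 := by positivity
    have : ε / (2 * (|T| + 1)) * (r * x) = ε / 2 * r * (x / (|T| + 1)) := by field_simp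
    rw [this]
    exact mul_le_of_le_one_right (by positivity) ((div_le_one hT).2 hxT)
  linarith

namespace SwapNetwork

variable {S : ℕ} (N : SwapNetwork S)

theorem ae_mem_fsllnSet {Ω : Type*} [MeasurableSpace Ω] {P : Measure Ω}
    {Lam : N.graph.edgeSet → ℝ≥0 → Ω → ℕ} {V : Fin S → ℝ≥0 → Ω → ℕ}
    (hprim : N.IsPrimitive P Lam V) : ∀ᵐ ω ∂P, ω ∈ N.fsllnSet Lam V := by
  have h1 := ae_all_iff.2 fun e => (hprim.arrivals e).ae_tendsto_div_natCast
  have h2 := ae_all_iff.2 fun j => (hprim.services j).ae_tendsto_div_natCast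
  filter_upwards [h1, h2] with ω hω1 hω2
  refine ⟨fun e T => ?_, fun j T => ?_⟩
  · have ha : 0 ≤ N.p e * N.lam := mul_nonneg (N.p_nonneg _) N.lam_pos.le
    have := hω1 e
    rw [Real.coe_toNNReal _ ha] at this
    exact tendstoUniformlyOn_scaled_of_tendsto_div ((hprim.arrivals e).mono ω) ha this T
  · have := hω2 j
    rw [Real.coe_toNNReal _ N.mu_pos.le] at this
    exact tendstoUniformlyOn_scaled_of_tendsto_div ((hprim.services j).mono ω) N.mu_pos.le this T

end SwapNetwork

/-! ### Asymptotically Lipschitz sequences of functions -/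

/-- The functions `f l` on `[0, ∞)` are, in the limit `l → ∞`, Lipschitz continuous with constant
`K`: on each bounded interval the Lipschitz estimate holds up to an error that vanishes. The
functions themselves may jump. -/
def AsympLipschitz (K : ℝ≥0) (f : ℕ → ℝ → ℝ) : Prop :=
  ∀ T : ℝ, ∀ ε > 0, ∀ᶠ l in atTop, ∀ s ∈ Icc 0 T, ∀ t ∈ Icc 0 T,
    |f l s - f l t| ≤ K * |s - t| + ε

namespace AsympLipschitz

variable {K K' : ℝ≥0} {f g : ℕ → ℝ → ℝ}

theorem of_le_add (hf : AsympLipschitz K f)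
    (h : ∀ T : ℝ, ∀ ε > 0, ∀ᶠ l in atTop, ∀ s ∈ Icc 0 T, ∀ t ∈ Icc 0 T,
      |g l s - g l t| ≤ |f l s - f l t| + ε) : AsympLipschitz K g := by
  intro T ε hε
  filter_upwards [hf T (ε / 2) (by positivity), h T (ε / 2) (by positivity)] with l h1 h2 s hs t ht
  linarith [h1 s hs t ht, h2 s hs t ht]

theorem of_le (hf : AsympLipschitz K f)
    (h : ∀ᶠ l in atTop, ∀ s, 0 ≤ s → ∀ t, 0 ≤ t → |g l s - g l t| ≤ |f l s - f l t|) :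
    AsympLipschitz K g :=
  hf.of_le_add fun _ _ hε => h.mono fun _ h s hs t ht =>
    (h s hs.1 t ht.1).trans (le_add_of_nonneg_right hε.le)

theorem of_lipschitz
    (h : ∀ᶠ l in atTop, ∀ s, 0 ≤ s → ∀ t, 0 ≤ t → |f l s - f l t| ≤ K * |s - t|) :
    AsympLipschitz K f := fun _ _ hε => h.mono fun _ h s hs t ht =>
  (h s hs.1 t ht.1).trans (le_add_of_nonneg_right hε.le)

theorem const_mul (hf : AsympLipschitz K f) (a : ℝ) :
    AsympLipschitz (‖a‖₊ * K) fun l t => a * f l t := by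
  intro T ε hε
  filter_upwards [hf T (ε / (|a| + 1)) (by positivity)] with l h s hs t ht
  have h1 := h s hs t ht
  have h2 : |a| * (ε / (|a| + 1)) ≤ ε := by
    rw [mul_div_assoc', div_le_iff₀ (by positivity)]
    nlinarith [abs_nonneg a]
  rw [← mul_sub, abs_mul]
  push_cast
  rw [Real.norm_eq_abs]
  nlinarith [mul_le_mul_of_nonneg_left h1 (abs_nonneg a)]

theorem add (hf : AsympLipschitz K f) (hg : AsympLipschitz K' g) :
    AsympLipschitz (K + K') fun l t => f l t + g l t := by
  intro T ε hε
  filter_upwards [hf T (ε / 2) (by positivity), hg T (ε / 2) (by positivity)] with l h1 h2 s hs t ht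
  have h3 := h1 s hs t ht
  have h4 := h2 s hs t ht
  have h5 : f l s + g l s - (f l t + g l t) = (f l s - f l t) + (g l s - g l t) := by ring
  rw [h5]
  push_cast
  linarith [abs_add_le (f l s - f l t) (g l s - g l t)]

theorem sub (hf : AsympLipschitz K f) (hg : AsympLipschitz K' g) :
    AsympLipschitz (K + K') fun l t => f l t - g l t := by
  have h : AsympLipschitz K' fun l t => -g l t := hg.of_le <|
      Eventually.of_forall fun l s _ t _ => by
    rw [← abs_neg]
    exact le_of_eq (congrArg _ (by ring))
  simpa only [sub_eq_add_neg] using hf.add h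

theorem sum {ι : Type*} (s : Finset ι) {K : ι → ℝ≥0} {f : ι → ℕ → ℝ → ℝ}
    (hf : ∀ i, AsympLipschitz (K i) (f i)) :
    AsympLipschitz (∑ i ∈ s, K i) fun l t => ∑ i ∈ s, f i l t := by
  classical
  induction s using Finset.induction_on with
  | empty => exact of_lipschitz (Eventually.of_forall fun l s _ t _ => by simp)
  | insert a s ha ih =>
    simp only [Finset.sum_insert ha]
    exact (hf a).add ih

theorem comp (hf : AsympLipschitz K f) {φ : ℕ → ℕ} (hφ : Tendsto φ atTop atTop) :
    AsympLipschitz K fun l => f (φ l) := fun T ε hε => hφ.eventually (hf T ε hε)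

theorem lipschitzOnWith_of_tendsto (hf : AsympLipschitz K f) {x : ℝ → ℝ}
    (hx : ∀ t, 0 ≤ t → Tendsto (fun l => f l t) atTop (𝓝 (x t))) :
    LipschitzOnWith K x (Ici 0) := by
  refine LipschitzOnWith.of_dist_le_mul fun s hs t ht => ?_
  rw [Real.dist_eq, Real.dist_eq]
  refine le_of_forall_pos_le_add fun ε hε => ?_
  refine le_of_tendsto ((hx s hs).sub (hx t ht)).abs ?_
  filter_upwards [hf (max s t) ε hε] with l hl
  exact hl s ⟨hs, le_max_left _ _⟩ t ⟨ht, le_max_right _ _⟩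

/-- Convergence at the points `k / (n + 1)` upgrades to a uniform Cauchy property on compacts. -/
theorem uniformCauchySeqOn (hf : AsympLipschitz K f) {x : ℕ × ℕ → ℝ}
    (hx : ∀ k n : ℕ, Tendsto (fun l => f l ((k : ℝ) / (n + 1))) atTop (𝓝 (x (k, n)))) (T : ℝ) :
    UniformCauchySeqOn f atTop (Icc 0 T) := by
  rw [Metric.uniformCauchySeqOn_iff]
  intro ε hε
  obtain ⟨n, hn⟩ := exists_nat_gt (10 * (K : ℝ) / ε)
  have hn1 : (0 : ℝ) < n + 1 := by positivity
  have hK : (K : ℝ) / (n + 1) ≤ ε / 10 := by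
    rw [div_le_iff₀ hn1]
    rw [div_lt_iff₀ hε] at hn
    nlinarith
  have hgrid : ∀ᶠ l in atTop, ∀ k ∈ Finset.range (⌊T * (n + 1)⌋₊ + 1),
      |f l ((k : ℝ) / (n + 1)) - x (k, n)| < ε / 10 := by
    rw [Filter.eventually_all_finset]
    intro k _
    have := (Metric.tendsto_nhds.1 (hx k n)) (ε / 10) (by positivity)
    simpa only [Real.dist_eq] using this
  obtain ⟨l₀, hl₀⟩ := eventually_atTop.1 (hgrid.and (hf T (ε / 10) (by positivity)))
  have key : ∀ l ≥ l₀, ∀ t ∈ Icc 0 T,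
      |f l t - x (⌊t * (n + 1)⌋₊, n)| < ε / 2 := by
    intro l hl t ht
    obtain ⟨h1, h2⟩ := hl₀ l hl
    set k := ⌊t * (n + 1)⌋₊ with hk
    have htn : 0 ≤ t * (n + 1) := mul_nonneg ht.1 hn1.le
    have hkt : (k : ℝ) / (n + 1) ≤ t := by
      rw [div_le_iff₀ hn1]
      exact Nat.floor_le htn
    have htk : t ≤ (k : ℝ) / (n + 1) + 1 / (n + 1) := by
      rw [← add_div, le_div_iff₀ hn1]
      exact (Nat.lt_floor_add_one _).le
    have hkr : k ∈ Finset.range (⌊T * (n + 1)⌋₊ + 1) := by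
      rw [Finset.mem_range, Nat.lt_succ_iff]
      exact Nat.floor_mono (mul_le_mul_of_nonneg_right ht.2 hn1.le)
    have h3 := h1 k hkr
    have h4 := h2 t ht _ ⟨by positivity, hkt.trans ht.2⟩
    have h5 : |t - (k : ℝ) / (n + 1)| ≤ 1 / (n + 1) := by
      rw [abs_of_nonneg (by linarith)]
      linarith
    have h6 : (K : ℝ) * |t - (k : ℝ) / (n + 1)| ≤ ε / 10 := by
      refine (mul_le_mul_of_nonneg_left h5 K.2).trans ?_
      rwa [mul_one_div]
    have h7 := abs_sub_le (f l t) (f l ((k : ℝ) / (n + 1))) (x (k, n))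
    linarith
  refine ⟨l₀, fun m hm l hl t ht => ?_⟩
  have h1 := key m hm t ht
  have h2 := key l hl t ht
  rw [abs_sub_comm] at h2
  rw [Real.dist_eq]
  linarith [abs_sub_le (f m t) (x (⌊t * (n + 1)⌋₊, n)) (f l t)]

theorem exists_bound (hf : AsympLipschitz K f) (h0 : ∃ M, ∀ᶠ l in atTop, |f l 0| ≤ M) {t : ℝ}
    (ht : 0 ≤ t) : ∃ M, ∀ l, |f l t| ≤ M := by
  obtain ⟨M, hM⟩ := h0
  have h : IsBoundedUnder (· ≤ ·) atTop fun l => |f l t| := by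
    refine ⟨M + (K * t + 1), ?_⟩
    rw [eventually_map]
    filter_upwards [hM, hf t 1 one_pos] with l h1 h2
    have h3 := h2 t ⟨ht, le_rfl⟩ 0 ⟨le_rfl, ht⟩
    rw [sub_zero, abs_of_nonneg ht] at h3
    have h4 := abs_sub_abs_le_abs_sub (f l t) (f l 0)
    linarith
  obtain ⟨B, hB⟩ := h.bddAbove_range
  exact ⟨B, fun l => hB ⟨l, rfl⟩⟩

/-- **Arzelà–Ascoli theorem** for countably many asymptotically Lipschitz sequences: along a common
subsequence all of them converge uniformly on compact sets. -/
theorem exists_subseq_tendstoUniformlyOn {ι : Type*} [Countable ι] {K : ι → ℝ≥0}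
    {f : ι → ℕ → ℝ → ℝ} (hf : ∀ i, AsympLipschitz (K i) (f i))
    (h0 : ∀ i, ∃ M, ∀ᶠ l in atTop, |f i l 0| ≤ M) :
    ∃ φ : ℕ → ℕ, StrictMono φ ∧ ∃ x : ι → ℝ → ℝ, ∀ i (T : ℝ),
      TendstoUniformlyOn (fun l => f i (φ l)) (x i) atTop (Icc 0 T) := by
  have hb : ∀ a : ι × ℕ × ℕ, ∃ M, ∀ l, |f a.1 l ((a.2.1 : ℝ) / (a.2.2 + 1))| ≤ M :=
    fun a => (hf a.1).exists_bound (h0 a.1) (by positivity)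
  choose M hM using hb
  -- The values on the countable grid lie in a compact product of intervals.
  have hcpt : IsCompact (Set.pi univ fun a : ι × ℕ × ℕ => Icc (-M a) (M a)) :=
    isCompact_univ_pi fun _ => isCompact_Icc
  obtain ⟨y, -, φ, hφ, hy⟩ := hcpt.tendsto_subseq
    (x := fun l a => f a.1 l ((a.2.1 : ℝ) / (a.2.2 + 1)))
    (fun l a _ => abs_le.1 (hM a l))
  rw [tendsto_pi_nhds] at hy
  have hcauchy : ∀ i T, UniformCauchySeqOn (fun l => f i (φ l)) atTop (Icc 0 T) := fun i T =>
    ((hf i).comp hφ.tendsto_atTop).uniformCauchySeqOn (x := fun kn => y (i, kn))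
      (fun k n => hy (i, k, n)) T
  refine ⟨φ, hφ, fun i t => limUnder atTop fun l => f i (φ l) t, fun i T => ?_⟩
  refine (hcauchy i T).tendstoUniformlyOn_of_tendsto fun t ht => ?_
  exact ((hcauchy i T).cauchySeq ht).tendsto_limUnder

end AsympLipschitz

namespace SwapNetwork

variable {S : ℕ} (N : SwapNetwork S)

/-! ### Effective arrival probabilities and capacities -/

/-- Summing over ordered pairs counts each edge twice. -/
theorem sum_sum_sym2_eq_two_mul_sum (f : Sym2 (Fin S) → ℝ) (hf : ∀ i, f s(i, i) = 0) :
    ∑ i, ∑ j, f s(i, j) = 2 * ∑ e, f e := by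
  classical
  rw [← Fintype.sum_prod_type' (f := fun i j : Fin S => f s(i, j)),
    ← Finset.sum_fiberwise Finset.univ (fun a : Fin S × Fin S => s(a.1, a.2)), Finset.mul_sum]
  refine Finset.sum_congr rfl fun e _ => ?_
  induction e using Sym2.ind with
  | _ a b =>
    have h1 : ∑ x : Fin S × Fin S with s(x.1, x.2) = s(a, b), f s(x.1, x.2)
        = ∑ x : Fin S × Fin S with s(x.1, x.2) = s(a, b), f s(a, b) :=
      Finset.sum_congr rfl fun x hx => by rw [(Finset.mem_filter.1 hx).2]
    rw [h1]
    by_cases hab : a = b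
    · subst hab
      simp [hf]
    · have h2 : Finset.univ.filter (fun x : Fin S × Fin S => s(x.1, x.2) = s(a, b))
          = {(a, b), (b, a)} := by
        ext ⟨c, d⟩
        simp [Prod.ext_iff]
      have h3 : (a, b) ≠ (b, a) := fun h => hab (Prod.ext_iff.1 h).1
      rw [h2, Finset.sum_pair h3]
      ring

theorem sum_effProb : ∑ i, N.effProb i = 1 := by
  have h := sum_sum_sym2_eq_two_mul_sum N.p N.p_diag
  simp only [effProb, ← Finset.sum_div]
  rw [h, N.p_sum]
  norm_num

theorem effProb_nonneg (i : Fin S) : 0 ≤ N.effProb i :=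
  Finset.sum_nonneg fun _ _ => div_nonneg (N.p_nonneg _) zero_le_two

/-- In a connected network each station has positive arrival probability: as `p` sums to `1` there
are at least two stations, so every station has a neighbour. -/
theorem effProb_pos (hconn : N.graph.Connected) (i : Fin S) : 0 < N.effProb i := by
  classical
  obtain ⟨e, he⟩ : ∃ e, 0 < N.p e := by
    by_contra! h
    have : ∑ e, N.p e ≤ 0 := Finset.sum_nonpos fun e _ => h e
    linarith [N.p_sum]
  have hnt : Nontrivial (Fin S) := by
    induction e using Sym2.ind with
    | _ a b =>
      refine ⟨a, b, fun hab => ?_⟩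
      rw [hab, N.p_diag] at he
      exact lt_irrefl _ he
  obtain ⟨j, hj⟩ := hconn.preconnected.exists_adj_of_nontrivial i
  have hle : N.p s(i, j) / 2 ≤ N.effProb i :=
    Finset.single_le_sum (f := fun j => N.p s(i, j) / 2)
      (fun _ _ => div_nonneg (N.p_nonneg _) zero_le_two) (Finset.mem_univ j)
  have : 0 < N.p s(i, j) := hj
  linarith

theorem IsRoundedCapacity.tendsto_div {c : ℝ} {C : ℕ → Fin S → ℕ} (hC : N.IsRoundedCapacity c C)
    (i : Fin S) :
    Tendsto (fun r : ℕ => (C r i : ℝ) / r) atTop (𝓝 (N.effProb i * N.lam / N.mu)) := by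
  have hinv : Tendsto (fun r : ℕ => 1 / (r : ℝ)) atTop (𝓝 0) :=
    tendsto_one_div_atTop_nhds_zero_nat
  have hsq : Tendsto (fun r : ℕ => Real.sqrt (N.lam / N.mu) * (c * Real.sqrt (1 / (r : ℝ))))
      atTop (𝓝 0) := by
    have := ((Real.continuous_sqrt.tendsto 0).comp hinv).const_mul c
    simpa using this.const_mul (Real.sqrt (N.lam / N.mu))
  have hnom : Tendsto (fun r : ℕ => N.nominalCapacity c r i / r) atTop
      (𝓝 (N.effProb i * N.lam / N.mu)) := by
    have h1 := (hsq.const_add (N.lam / N.mu)).const_mul (N.effProb i)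
    rw [add_zero, ← mul_div_assoc] at h1
    refine h1.congr' ?_
    filter_upwards [eventually_gt_atTop 0] with r hr
    have hr' : (0 : ℝ) < r := by exact_mod_cast hr
    have hs : Real.sqrt (1 / (r : ℝ)) = Real.sqrt r / r := by
      rw [Real.sqrt_div zero_le_one, Real.sqrt_one, div_eq_div_iff (by positivity) hr'.ne',
        one_mul, Real.mul_self_sqrt hr'.le]
    have hm : Real.sqrt (N.lam * r / N.mu) = Real.sqrt (N.lam / N.mu) * Real.sqrt r := by
      rw [mul_div_right_comm, Real.sqrt_mul (div_nonneg N.lam_pos.le N.mu_pos.le)]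
    rw [nominalCapacity, hm, hs]
    have := N.mu_pos.ne'
    field_simp
  have hmax : Tendsto (fun r : ℕ => max (N.nominalCapacity c r i) 0 / r) atTop
      (𝓝 (N.effProb i * N.lam / N.mu)) := by
    have h1 := hnom.max (tendsto_const_nhds (x := (0 : ℝ)))
    rw [max_eq_left (div_nonneg (mul_nonneg (N.effProb_nonneg i) N.lam_pos.le) N.mu_pos.le)] at h1
    refine h1.congr fun r => ?_
    rw [← max_div_div_right (Nat.cast_nonneg r), zero_div]
  refine tendsto_of_tendsto_of_dist hmax (squeeze_zero (fun _ => dist_nonneg) (fun r => ?_) hinv)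
  rw [dist_comm, Real.dist_eq, ← sub_div, abs_div, Nat.abs_cast]
  exact div_le_div_of_nonneg_right (hC r i) (Nat.cast_nonneg r)

/-! ### Estimates for a single path of the system -/

theorem sum_neighborSet_eq (j : Fin S) [Fintype (N.graph.neighborSet j)]
    (f : ∀ i, N.graph.Adj j i → ℝ) [DecidableRel N.graph.Adj] :
    ∑ i : N.graph.neighborSet j, f i i.2
      = ∑ i, if h : N.graph.Adj j i then f i h else 0 := by
  classical
  have h1 : ∑ i : N.graph.neighborSet j, f i i.2
      = ∑ i : N.graph.neighborSet j, if h : N.graph.Adj j i then f i h else 0 :=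
    Finset.sum_congr rfl fun i _ => (dif_pos (show N.graph.Adj j i from i.2)).symm
  rw [h1, ← Finset.sum_subset (Finset.subset_univ (N.graph.neighborSet j).toFinset),
    ← Finset.sum_set_coe]
  intro i _ hi
  rw [dif_neg]
  simpa using hi

namespace IsSystemPath

open SwapNetwork.Comp

variable {N} {r : ℕ} {B F : Fin S → ℕ} {Lam : N.graph.edgeSet → ℝ≥0 → ℕ} {V : Fin S → ℝ≥0 → ℕ}
  {x : N.Path}

theorem queue_nonneg (h : N.IsSystemPath r B F Lam V x) (j : Fin S) {t : ℝ} (ht : 0 ≤ t) :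
    0 ≤ x (queue j) t := by
  obtain ⟨n, hn⟩ := h.queue_nat j t ht
  rw [hn]
  positivity

theorem driving_nonneg (h : N.IsSystemPath r B F Lam V x) {t : ℝ} (ht : 0 ≤ t) :
    0 ≤ x driving t := by
  obtain ⟨n, hn⟩ := h.driving_nat t ht
  rw [hn]
  positivity

theorem driving_le (h : N.IsSystemPath r B F Lam V x) {t : ℝ} (ht : 0 ≤ t) :
    x driving t ≤ r := by
  rw [h.driving_eq t ht]
  linarith [Finset.sum_nonneg fun j (_ : j ∈ Finset.univ) => le_max_right (x (queue j) t - B j) 0]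

theorem queue_le (h : N.IsSystemPath r B F Lam V x) (j : Fin S) {t : ℝ} (ht : 0 ≤ t) :
    x (queue j) t ≤ B j + r := by
  have h1 := h.driving_nonneg ht
  rw [h.driving_eq t ht] at h1
  have h2 : max (x (queue j) t - B j) 0 ≤ ∑ j, max (x (queue j) t - B j) 0 :=
    Finset.single_le_sum (f := fun j => max (x (queue j) t - B j) 0)
      (fun _ _ => le_max_right _ _) (Finset.mem_univ j)
  linarith [le_max_left (x (queue j) t - B j) 0]

theorem busy_nonneg (h : N.IsSystemPath r B F Lam V x) (j : Fin S) {t : ℝ} (ht : 0 ≤ t) :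
    0 ≤ x (busy j) t := by
  rw [h.busy_eq j t ht]
  exact le_min (h.queue_nonneg j ht) (Nat.cast_nonneg _)

theorem busy_le (h : N.IsSystemPath r B F Lam V x) (j : Fin S) {t : ℝ} (ht : 0 ≤ t) :
    x (busy j) t ≤ F j := by
  rw [h.busy_eq j t ht]
  exact min_le_right _ _

/-- A queue length is integrable over bounded intervals, being a combination of monotone counting
paths. -/
theorem queue_integrableOn (h : N.IsSystemPath r B F Lam V x) (j : Fin S) (T : ℝ) :
    IntegrableOn (x (queue j)) (Icc 0 T) := by
  classical
  have hm : ∀ f : ℝ → ℝ, IsCountingPath f → IntegrableOn f (Icc 0 T) := fun f hf =>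
    (hf.2.mono Icc_subset_Ici_self).integrableOn_isCompact isCompact_Icc
  have hs : IntegrableOn (fun t => x (queue j) 0 +
      ∑ i : N.graph.neighborSet j, x (routed j i i.2) t - x (compl j) t) (Icc 0 T) :=
    Integrable.sub (Integrable.add (integrable_const _)
      (integrable_finsetSum _ fun i _ => hm _ (h.routed_counting j i i.2)))
      (hm _ (h.compl_counting j))
  refine hs.congr_fun (fun t ht => ?_) measurableSet_Icc
  rw [h.queue_eq j t ht.1]

theorem busy_integrableOn (h : N.IsSystemPath r B F Lam V x) (j : Fin S) (T : ℝ) :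
    IntegrableOn (x (busy j)) (Icc 0 T) := by
  have hs : IntegrableOn (fun t => min (x (queue j) t) (F j)) (Icc 0 T) :=
    Integrable.inf (h.queue_integrableOn j T) (integrable_const _)
  exact hs.congr_fun (fun t ht => (h.busy_eq j t ht.1).symm) measurableSet_Icc

theorem driving_integrableOn (h : N.IsSystemPath r B F Lam V x) (T : ℝ) :
    IntegrableOn (x driving) (Icc 0 T) := by
  have hs : IntegrableOn (fun t => (r : ℝ) - ∑ j, max (x (queue j) t - B j) 0) (Icc 0 T) :=
    Integrable.sub (integrable_const _) (integrable_finsetSum _ fun j _ =>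
      Integrable.sup (Integrable.sub (h.queue_integrableOn j T) (integrable_const _))
        (integrable_const _))
  exact hs.congr_fun (fun t ht => (h.driving_eq t ht.1).symm) measurableSet_Icc

end IsSystemPath

end SwapNetwork

/-- The integral of a function with values in `[0, C]` is Lipschitz with constant `C`. -/
theorem abs_sub_le_of_eq_integral {g Y : ℝ → ℝ} {C : ℝ}
    (hint : ∀ T, IntegrableOn g (Icc 0 T)) (h0 : ∀ t, 0 ≤ t → 0 ≤ g t)
    (hC : ∀ t, 0 ≤ t → g t ≤ C) (hY : ∀ t, 0 ≤ t → Y t = ∫ s in (0 : ℝ)..t, g s)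
    {s t : ℝ} (hs : 0 ≤ s) (ht : 0 ≤ t) : |Y s - Y t| ≤ C * |s - t| := by
  have hii : ∀ t, 0 ≤ t → IntervalIntegrable g volume 0 t := fun t ht =>
    (intervalIntegrable_iff_integrableOn_Icc_of_le ht).2 (hint t)
  rw [hY s hs, hY t ht, intervalIntegral.integral_interval_sub_left (hii s hs) (hii t ht),
    ← Real.norm_eq_abs]
  refine intervalIntegral.norm_integral_le_of_norm_le_const fun u hu => ?_
  have hu0 : 0 ≤ u := (le_min ht hs).trans hu.1.le
  rw [Real.norm_eq_abs, abs_of_nonneg (h0 u hu0)]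
  exact hC u hu0

namespace SwapNetwork.IsSystemPath

open SwapNetwork.Comp

variable {S : ℕ} {N : SwapNetwork S} {r : ℕ} {B F : Fin S → ℕ}
  {Lam : N.graph.edgeSet → ℝ≥0 → ℕ} {V : Fin S → ℝ≥0 → ℕ} {x : N.Path}

theorem abs_driveTime_sub_le (h : N.IsSystemPath r B F Lam V x) {s t : ℝ} (hs : 0 ≤ s)
    (ht : 0 ≤ t) : |x driveTime s - x driveTime t| ≤ r * |s - t| :=
  abs_sub_le_of_eq_integral h.driving_integrableOn (fun _ => h.driving_nonneg)
    (fun _ => h.driving_le) h.driveTime_eq hs ht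

theorem abs_busyTime_sub_le (h : N.IsSystemPath r B F Lam V x) (j : Fin S) {s t : ℝ} (hs : 0 ≤ s)
    (ht : 0 ≤ t) : |x (busyTime j) s - x (busyTime j) t| ≤ F j * |s - t| :=
  abs_sub_le_of_eq_integral (h.busy_integrableOn j) (fun _ => h.busy_nonneg j)
    (fun _ => h.busy_le j) (h.busyTime_eq j) hs ht

theorem driveTime_mem (h : N.IsSystemPath r B F Lam V x) {t : ℝ} (ht : 0 ≤ t) :
    x driveTime t ∈ Icc 0 (r * t) := by
  have h1 := h.abs_driveTime_sub_le ht le_rfl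
  rw [h.driveTime_eq 0 le_rfl, intervalIntegral.integral_same, sub_zero, sub_zero,
    abs_of_nonneg ht] at h1
  refine ⟨?_, (le_abs_self _).trans h1⟩
  rw [h.driveTime_eq t ht]
  exact intervalIntegral.integral_nonneg ht fun u hu => h.driving_nonneg hu.1

theorem busyTime_mem (h : N.IsSystemPath r B F Lam V x) (j : Fin S) {t : ℝ} (ht : 0 ≤ t) :
    x (busyTime j) t ∈ Icc 0 (F j * t) := by
  have h1 := h.abs_busyTime_sub_le j ht le_rfl
  rw [h.busyTime_eq j 0 le_rfl, intervalIntegral.integral_same, sub_zero, sub_zero,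
    abs_of_nonneg ht] at h1
  refine ⟨?_, (le_abs_self _).trans h1⟩
  rw [h.busyTime_eq j t ht]
  exact intervalIntegral.integral_nonneg ht fun u hu => h.busy_nonneg j hu.1

/-- A routed stream changes at most as much as the arrival stream of its edge, since both streams
into which the latter splits are nondecreasing. -/
theorem abs_routed_sub_le (h : N.IsSystemPath r B F Lam V x) {i j : Fin S} (hij : N.graph.Adj i j)
    {s t : ℝ} (hs : 0 ≤ s) (ht : 0 ≤ t) :
    |x (routed i j hij) s - x (routed i j hij) t|
      ≤ |x (arr ⟨s(i, j), hij⟩) s - x (arr ⟨s(i, j), hij⟩) t| := by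
  wlog hst : t ≤ s generalizing s t
  · rw [abs_sub_comm, abs_sub_comm (x (arr _) s)]
    exact this ht hs (le_of_not_ge hst)
  have h1 := (h.routed_counting i j hij).2 ht hs hst
  have h2 := (h.routed_counting j i hij.symm).2 ht hs hst
  rw [h.arr_split i j hij s hs, h.arr_split i j hij t ht, abs_of_nonneg (by linarith),
    abs_of_nonneg (by linarith)]
  linarith

theorem abs_busy_sub_le (h : N.IsSystemPath r B F Lam V x) (j : Fin S) {s t : ℝ} (hs : 0 ≤ s)
    (ht : 0 ≤ t) : |x (busy j) s - x (busy j) t| ≤ |x (queue j) s - x (queue j) t| := by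
  rw [h.busy_eq j s hs, h.busy_eq j t ht]
  simpa using abs_min_sub_min_le_max (x (queue j) s) (F j) (x (queue j) t) (F j)

end SwapNetwork.IsSystemPath

/-! ### Compactness of the fluid-scaled paths -/

/-- The random time change: a scaled counting function that is uniformly close to a line, evaluated
at asymptotically Lipschitz times, is asymptotically Lipschitz. -/
theorem AsympLipschitz.time_change {K C : ℝ≥0} {a : ℝ} {G f g : ℕ → ℝ → ℝ}
    (hG : ∀ T : ℝ, TendstoUniformlyOn G (fun y => a * y) atTop (Icc 0 T))
    (hg : AsympLipschitz K g) (hgC : ∀ᶠ l in atTop, ∀ t, 0 ≤ t → g l t ∈ Icc (0 : ℝ) (C * t))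
    (hfg : ∀ l t, 0 ≤ t → f l t = G l (g l t)) :
    AsympLipschitz (‖a‖₊ * K) f := by
  refine (hg.const_mul a).of_le_add fun T ε hε => ?_
  have h := Metric.tendstoUniformlyOn_iff.1 (hG (C * T)) (ε / 2) (by positivity)
  filter_upwards [h, hgC] with l h1 h2 s hs t ht
  have hmem : ∀ u ∈ Icc (0 : ℝ) T, g l u ∈ Icc 0 (C * T) := fun u hu =>
    ⟨(h2 u hu.1).1, (h2 u hu.1).2.trans (mul_le_mul_of_nonneg_left hu.2 C.2)⟩
  have h3 := h1 _ (hmem s hs)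
  have h4 := h1 _ (hmem t ht)
  rw [dist_comm, Real.dist_eq] at h3
  rw [Real.dist_eq] at h4
  rw [hfg l s hs.1, hfg l t ht.1]
  have h5 : G l (g l s) - G l (g l t) = (a * g l s - a * g l t) +
      ((G l (g l s) - a * g l s) + (a * g l t - G l (g l t))) := by ring
  rw [h5]
  refine (abs_add_le _ _).trans (add_le_add_right ((abs_add_le _ _).trans ?_) _)
  linarith

theorem tendsto_time_change {C t y : ℝ} {a : ℝ} {G : ℕ → ℝ → ℝ} {g : ℕ → ℝ}
    (hG : ∀ T : ℝ, TendstoUniformlyOn G (fun y => a * y) atTop (Icc 0 T))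
    (hgC : ∀ᶠ l in atTop, g l ∈ Icc 0 (C * t)) (hy : Tendsto g atTop (𝓝 y)) :
    Tendsto (fun l => G l (g l)) atTop (𝓝 (a * y)) := by
  rw [← tendsto_sub_nhds_zero_iff]
  have h1 : Tendsto (fun l => G l (g l) - a * g l) atTop (𝓝 0) := by
    rw [Metric.tendsto_nhds]
    intro ε hε
    filter_upwards [Metric.tendstoUniformlyOn_iff.1 (hG (C * t)) ε hε, hgC] with l h1 h2
    have := h1 _ h2
    rwa [dist_comm, Real.dist_eq, ← Real.norm_eq_abs, ← dist_zero_right] at this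
  have h2 : Tendsto (fun l => a * g l - a * y) atTop (𝓝 0) :=
    tendsto_sub_nhds_zero_iff.2 (hy.const_mul a)
  simpa using h1.add h2

namespace SwapNetwork

variable {S : ℕ} {N : SwapNetwork S}

instance : Countable N.Comp := by
  let g : N.Comp → N.graph.edgeSet ⊕ (Fin S × Fin S) ⊕ (Fin S × Fin 4) ⊕ Bool := fun c =>
    match c with
    | .arr e => .inl e
    | .routed i j _ => .inr (.inl (i, j))
    | .queue j => .inr (.inr (.inl (j, 0)))
    | .busy j => .inr (.inr (.inl (j, 1)))
    | .busyTime j => .inr (.inr (.inl (j, 2)))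
    | .compl j => .inr (.inr (.inl (j, 3)))
    | .driveTime => .inr (.inr (.inr true))
    | .driving => .inr (.inr (.inr false))
  refine Function.Injective.countable (f := g) fun a b hab => ?_
  cases a <;> cases b <;> simp_all [g]

variable {Ω : Type*}

/-- The path of component `c` at the sample point `ω`, scaled by the number of cars, along the
sequence `rl` of numbers of cars. -/
noncomputable def scaledPath (X : ℕ → Ω → N.Path) (ω : Ω) (rl : ℕ → ℕ) (c : N.Comp) (l : ℕ)
    (t : ℝ) : ℝ :=
  X (rl l) ω c t / rl l

/-- What the fluid limit along `rl` at the sample point `ω` depends on: each system satisfies the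
system identities at `ω`, the law of large numbers holds at `ω`, and the capacities are of
order `r`. -/
structure IsScalingSequence (N : SwapNetwork S) (B F : ℕ → Fin S → ℕ)
    (Lam : N.graph.edgeSet → ℝ≥0 → Ω → ℕ) (V : Fin S → ℝ≥0 → Ω → ℕ) (X : ℕ → Ω → N.Path)
    (ω : Ω) (rl : ℕ → ℕ) : Prop where
  path : ∀ r, N.IsSystemPath r (B r) (F r) (fun e t => Lam e t ω) (fun j t => V j t ω) (X r ω)
  fslln : ω ∈ N.fsllnSet Lam V
  tendsto_seq : Tendsto rl atTop atTop
  spare : ∀ j, Tendsto (fun r : ℕ => (B r j : ℝ) / r) atTop (𝓝 (N.effProb j * N.lam / N.mu))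
  points : ∀ j, Tendsto (fun r : ℕ => (F r j : ℝ) / r) atTop (𝓝 (N.effProb j * N.lam / N.mu))

namespace IsScalingSequence

variable {B F : ℕ → Fin S → ℕ} {Lam : N.graph.edgeSet → ℝ≥0 → Ω → ℕ}
  {V : Fin S → ℝ≥0 → Ω → ℕ} {X : ℕ → Ω → N.Path} {ω : Ω} {rl : ℕ → ℕ}

theorem eventually_pos (h : IsScalingSequence N B F Lam V X ω rl) :
    ∀ᶠ l in atTop, (0 : ℝ) < rl l := by
  filter_upwards [h.tendsto_seq.eventually_gt_atTop 0] with l hl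
  exact_mod_cast hl

/-- A pathwise bound on increments carries over to the scaled paths. -/
theorem asympLipschitz_of_le (h : IsScalingSequence N B F Lam V X ω rl) {c d : N.Comp} {K : ℝ≥0}
    (hd : AsympLipschitz K (scaledPath X ω rl d))
    (hle : ∀ r s t, 0 ≤ s → 0 ≤ t → |X r ω c s - X r ω c t| ≤ |X r ω d s - X r ω d t|) :
    AsympLipschitz K (scaledPath X ω rl c) := by
  refine hd.of_le (h.eventually_pos.mono fun l hl s hs t ht => ?_)
  simp only [scaledPath, ← sub_div, abs_div]
  exact div_le_div_of_nonneg_right (hle _ s t hs ht) (abs_nonneg _)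

theorem driveTime_mem (h : IsScalingSequence N B F Lam V X ω rl) :
    ∀ᶠ l in atTop, ∀ t, 0 ≤ t →
      scaledPath X ω rl .driveTime l t ∈ Icc (0 : ℝ) ((1 : ℝ≥0) * t) := by
  filter_upwards [h.eventually_pos] with l hl t ht
  obtain ⟨h1, h2⟩ := (h.path (rl l)).driveTime_mem ht
  refine ⟨div_nonneg h1 hl.le, ?_⟩
  rw [scaledPath, div_le_iff₀ hl]
  push_cast
  linarith

theorem asympLipschitz_driveTime (h : IsScalingSequence N B F Lam V X ω rl) :
    AsympLipschitz 1 (scaledPath X ω rl .driveTime) := by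
  refine AsympLipschitz.of_lipschitz (h.eventually_pos.mono fun l hl s hs t ht => ?_)
  rw [scaledPath, scaledPath, ← sub_div, abs_div, abs_of_pos hl, div_le_iff₀ hl]
  have := (h.path (rl l)).abs_driveTime_sub_le hs ht
  push_cast
  linarith

/-- A bound on the scaled number of charging points of station `j` in large systems. -/
noncomputable def pointBound (N : SwapNetwork S) (j : Fin S) : ℝ≥0 :=
  (N.effProb j * N.lam / N.mu + 1).toNNReal

theorem eventually_points_le (h : IsScalingSequence N B F Lam V X ω rl) (j : Fin S) :
    ∀ᶠ l in atTop, (F (rl l) j : ℝ) ≤ pointBound N j * rl l := by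
  filter_upwards [h.eventually_pos, (h.tendsto_seq.eventually
    ((h.points j).eventually (eventually_le_nhds (lt_add_one _))))] with l hl h1
  rw [div_le_iff₀ hl] at h1
  exact h1.trans (mul_le_mul_of_nonneg_right (Real.le_coe_toNNReal _) hl.le)

theorem busyTime_mem (h : IsScalingSequence N B F Lam V X ω rl) (j : Fin S) :
    ∀ᶠ l in atTop, ∀ t, 0 ≤ t →
      scaledPath X ω rl (.busyTime j) l t ∈ Icc (0 : ℝ) (pointBound N j * t) := by
  filter_upwards [h.eventually_pos, h.eventually_points_le j] with l hl hF t ht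
  obtain ⟨h1, h2⟩ := (h.path (rl l)).busyTime_mem j ht
  refine ⟨div_nonneg h1 hl.le, ?_⟩
  rw [scaledPath, div_le_iff₀ hl]
  nlinarith [mul_le_mul_of_nonneg_right hF ht]

theorem asympLipschitz_busyTime (h : IsScalingSequence N B F Lam V X ω rl) (j : Fin S) :
    AsympLipschitz (pointBound N j) (scaledPath X ω rl (.busyTime j)) := by
  refine AsympLipschitz.of_lipschitz ?_
  filter_upwards [h.eventually_pos, h.eventually_points_le j] with l hl hF s hs t ht
  rw [scaledPath, scaledPath, ← sub_div, abs_div, abs_of_pos hl, div_le_iff₀ hl]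
  have := (h.path (rl l)).abs_busyTime_sub_le j hs ht
  nlinarith [mul_le_mul_of_nonneg_right hF (abs_nonneg (s - t))]

theorem fslln_arrivals (h : IsScalingSequence N B F Lam V X ω rl) (e : N.graph.edgeSet) (T : ℝ) :
    TendstoUniformlyOn (fun (l : ℕ) (y : ℝ) => (Lam e (rl l * y).toNNReal ω : ℝ) / rl l)
      (fun y => N.p e * N.lam * y) atTop (Icc 0 T) := fun u hu =>
  h.tendsto_seq.eventually (h.fslln.1 e T u hu)

theorem fslln_services (h : IsScalingSequence N B F Lam V X ω rl) (j : Fin S) (T : ℝ) :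
    TendstoUniformlyOn (fun (l : ℕ) (y : ℝ) => (V j (rl l * y).toNNReal ω : ℝ) / rl l)
      (fun y => N.mu * y) atTop (Icc 0 T) := fun u hu =>
  h.tendsto_seq.eventually (h.fslln.2 j T u hu)

theorem scaledPath_arr (h : IsScalingSequence N B F Lam V X ω rl) (e : N.graph.edgeSet) (l : ℕ)
    (t : ℝ) (ht : 0 ≤ t) :
    scaledPath X ω rl (.arr e) l t
      = (Lam e (rl l * scaledPath X ω rl .driveTime l t).toNNReal ω : ℝ) / rl l := by
  rw [scaledPath, (h.path (rl l)).arr_eq e t ht, scaledPath]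
  -- In a system without cars both sides are `0`, as quotients by `0`.
  rcases Nat.eq_zero_or_pos (rl l) with h0 | h0
  · simp [h0]
  · rw [mul_div_cancel₀ _ (by positivity)]

theorem scaledPath_compl (h : IsScalingSequence N B F Lam V X ω rl) (j : Fin S) (l : ℕ)
    (t : ℝ) (ht : 0 ≤ t) :
    scaledPath X ω rl (.compl j) l t
      = (V j (rl l * scaledPath X ω rl (.busyTime j) l t).toNNReal ω : ℝ) / rl l := by
  rw [scaledPath, (h.path (rl l)).compl_eq j t ht, scaledPath]
  -- In a system without cars both sides are `0`, as quotients by `0`.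
  rcases Nat.eq_zero_or_pos (rl l) with h0 | h0
  · simp [h0]
  · rw [mul_div_cancel₀ _ (by positivity)]

theorem asympLipschitz_arr (h : IsScalingSequence N B F Lam V X ω rl) (e : N.graph.edgeSet) :
    ∃ K, AsympLipschitz K (scaledPath X ω rl (.arr e)) :=
  ⟨_, h.asympLipschitz_driveTime.time_change (h.fslln_arrivals e) h.driveTime_mem
    (h.scaledPath_arr e)⟩

theorem asympLipschitz_compl (h : IsScalingSequence N B F Lam V X ω rl) (j : Fin S) :
    ∃ K, AsympLipschitz K (scaledPath X ω rl (.compl j)) :=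
  ⟨_, (h.asympLipschitz_busyTime j).time_change (h.fslln_services j) (h.busyTime_mem j)
    (h.scaledPath_compl j)⟩

theorem asympLipschitz_routed (h : IsScalingSequence N B F Lam V X ω rl) (i j : Fin S)
    (hij : N.graph.Adj i j) : ∃ K, AsympLipschitz K (scaledPath X ω rl (.routed i j hij)) :=
  (h.asympLipschitz_arr ⟨s(i, j), hij⟩).imp fun _ hK =>
    h.asympLipschitz_of_le hK fun r _ _ hs ht => (h.path r).abs_routed_sub_le hij hs ht

theorem asympLipschitz_queue (h : IsScalingSequence N B F Lam V X ω rl) (j : Fin S) :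
    ∃ K, AsympLipschitz K (scaledPath X ω rl (.queue j)) := by
  classical
  choose K hK using fun i : N.graph.neighborSet j => h.asympLipschitz_routed j i i.2
  obtain ⟨K', hK'⟩ := h.asympLipschitz_compl j
  refine ⟨_, ((AsympLipschitz.sum Finset.univ hK).sub hK').of_le
    (Eventually.of_forall fun l s hs t ht => le_of_eq (congrArg _ ?_))⟩
  simp only [scaledPath]
  rw [(h.path (rl l)).queue_eq j s hs, (h.path (rl l)).queue_eq j t ht, ← Finset.sum_div,
    ← Finset.sum_div]
  ring

theorem asympLipschitz_driving (h : IsScalingSequence N B F Lam V X ω rl) :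
    ∃ K, AsympLipschitz K (scaledPath X ω rl .driving) := by
  choose K hK using h.asympLipschitz_queue
  have hpos : ∀ j, AsympLipschitz (K j)
      (fun l t => max (X (rl l) ω (.queue j) t - B (rl l) j) 0 / rl l) := fun j =>
    (hK j).of_le (h.eventually_pos.mono fun l hl s hs t ht => by
      simp only [scaledPath, ← sub_div, abs_div]
      refine div_le_div_of_nonneg_right ?_ (abs_nonneg _)
      simpa using abs_max_sub_max_le_max (X (rl l) ω (.queue j) s - B (rl l) j) 0
        (X (rl l) ω (.queue j) t - B (rl l) j) 0)
  refine ⟨_, (AsympLipschitz.sum Finset.univ hpos).of_le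
    (Eventually.of_forall fun l s hs t ht => ?_)⟩
  simp only [scaledPath]
  rw [(h.path (rl l)).driving_eq s hs, (h.path (rl l)).driving_eq t ht, ← Finset.sum_div,
    ← Finset.sum_div, abs_sub_comm]
  exact le_of_eq (congrArg _ (by ring))

theorem asympLipschitz (h : IsScalingSequence N B F Lam V X ω rl) (c : N.Comp) :
    ∃ K, AsympLipschitz K (scaledPath X ω rl c) := by
  cases c with
  | arr e => exact h.asympLipschitz_arr e
  | routed i j hij => exact h.asympLipschitz_routed i j hij
  | queue j => exact h.asympLipschitz_queue j
  | busy j => exact (h.asympLipschitz_queue j).imp fun _ hK =>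
      h.asympLipschitz_of_le hK fun r _ _ hs ht => (h.path r).abs_busy_sub_le j hs ht
  | driveTime => exact ⟨_, h.asympLipschitz_driveTime⟩
  | busyTime j => exact ⟨_, h.asympLipschitz_busyTime j⟩
  | compl j => exact h.asympLipschitz_compl j
  | driving => exact h.asympLipschitz_driving

/-- The scaled arrival process of an edge vanishes at time `0` in the limit. -/
theorem tendsto_arr_zero (h : IsScalingSequence N B F Lam V X ω rl) (e : N.graph.edgeSet) :
    Tendsto (fun l => scaledPath X ω rl (.arr e) l 0) atTop (𝓝 0) := by
  have hy : Tendsto (fun l => scaledPath X ω rl .driveTime l 0) atTop (𝓝 0) := by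
    refine tendsto_const_nhds.congr fun l => ?_
    rw [scaledPath, (h.path (rl l)).driveTime_eq 0 le_rfl, intervalIntegral.integral_same, zero_div]
  have := tendsto_time_change (h.fslln_arrivals e)
    (h.driveTime_mem.mono fun l hl => hl 0 le_rfl) hy
  rw [mul_zero] at this
  exact this.congr fun l => (h.scaledPath_arr e l 0 le_rfl).symm

theorem tendsto_compl_zero (h : IsScalingSequence N B F Lam V X ω rl) (j : Fin S) :
    Tendsto (fun l => scaledPath X ω rl (.compl j) l 0) atTop (𝓝 0) := by
  have hy : Tendsto (fun l => scaledPath X ω rl (.busyTime j) l 0) atTop (𝓝 0) := by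
    refine tendsto_const_nhds.congr fun l => ?_
    rw [scaledPath, (h.path (rl l)).busyTime_eq j 0 le_rfl, intervalIntegral.integral_same,
      zero_div]
  have := tendsto_time_change (h.fslln_services j)
    ((h.busyTime_mem j).mono fun l hl => hl 0 le_rfl) hy
  rw [mul_zero] at this
  exact this.congr fun l => (h.scaledPath_compl j l 0 le_rfl).symm

/-- The initial values of the scaled paths are bounded. For the queue lengths this holds because
the cars that wait are among the `r` cars of the system. -/
theorem exists_initial_bound (h : IsScalingSequence N B F Lam V X ω rl) (c : N.Comp) :
    ∃ M, ∀ᶠ l in atTop, |scaledPath X ω rl c l 0| ≤ M := by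
  have hsq : ∀ (d : N.Comp) (M : ℝ), (∀ r, 0 ≤ X r ω d 0) →
      (∀ᶠ l in atTop, X (rl l) ω d 0 ≤ M * rl l) →
      ∃ M, ∀ᶠ l in atTop, |scaledPath X ω rl d l 0| ≤ M := fun d M h0 hM => ⟨M, by
    filter_upwards [hM, h.eventually_pos] with l h1 hl
    rw [scaledPath, abs_of_nonneg (div_nonneg (h0 _) hl.le), div_le_iff₀ hl]
    exact h1⟩
  have hlim : ∀ d : N.Comp, Tendsto (fun l => scaledPath X ω rl d l 0) atTop (𝓝 0) →
      ∃ M, ∀ᶠ l in atTop, |scaledPath X ω rl d l 0| ≤ M := fun d hd => ⟨1, by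
    have := hd.abs
    rw [abs_zero] at this
    exact this.eventually (eventually_le_nhds one_pos)⟩
  have hnat : ∀ f, IsNatValuedPath f → 0 ≤ f 0 := fun f hf => by
    obtain ⟨n, hn⟩ := hf 0 le_rfl
    rw [hn]
    positivity
  cases c with
  | arr e => exact hlim _ (h.tendsto_arr_zero e)
  | routed i j hij =>
    obtain ⟨M, hM⟩ := hlim _ (h.tendsto_arr_zero ⟨s(i, j), hij⟩)
    refine ⟨M, hM.mono fun l hl => le_trans ?_ hl⟩
    have h1 := hnat _ ((h.path (rl l)).routed_counting i j hij).1
    have h2 := hnat _ ((h.path (rl l)).routed_counting j i hij.symm).1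
    simp only [scaledPath, abs_div]
    refine div_le_div_of_nonneg_right ?_ (abs_nonneg _)
    rw [(h.path (rl l)).arr_split i j hij 0 le_rfl, abs_of_nonneg h1, abs_of_nonneg (by linarith)]
    linarith
  | queue j =>
    refine hsq _ (N.effProb j * N.lam / N.mu + 1 + 1)
      (fun r => (h.path r).queue_nonneg j le_rfl) ?_
    filter_upwards [h.eventually_pos, (h.tendsto_seq.eventually
      ((h.spare j).eventually (eventually_le_nhds (lt_add_one _))))] with l hl h1
    rw [div_le_iff₀ hl] at h1
    linarith [(h.path (rl l)).queue_le j le_rfl]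
  | busy j =>
    refine hsq _ (pointBound N j) (fun r => (h.path r).busy_nonneg j le_rfl) ?_
    filter_upwards [h.eventually_points_le j] with l hl
    exact ((h.path (rl l)).busy_le j le_rfl).trans hl
  | driveTime =>
    refine ⟨0, Eventually.of_forall fun l => ?_⟩
    simp [scaledPath, (h.path (rl l)).driveTime_eq 0 le_rfl]
  | busyTime j =>
    refine ⟨0, Eventually.of_forall fun l => ?_⟩
    simp [scaledPath, (h.path (rl l)).busyTime_eq j 0 le_rfl]
  | compl j => exact hlim _ (h.tendsto_compl_zero j)
  | driving =>
    refine hsq _ 1 (fun r => (h.path r).driving_nonneg le_rfl) (Eventually.of_forall fun l => ?_)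
    rw [one_mul]
    exact (h.path (rl l)).driving_le le_rfl

theorem exists_subseq_fluidConverges (h : IsScalingSequence N B F Lam V X ω rl) :
    ∃ φ : ℕ → ℕ, StrictMono φ ∧ ∃ x : N.Path, N.FluidConverges X ω (rl ∘ φ) x := by
  choose K hK using h.asympLipschitz
  exact AsympLipschitz.exists_subseq_tendstoUniformlyOn hK h.exists_initial_bound

end IsScalingSequence

end SwapNetwork

/-! ### Properties of fluid limits -/

/-- The fundamental theorem of calculus on `[0, ∞)`. -/
theorem hasDerivWithinAt_Ici_of_eq_integral {g Y : ℝ → ℝ} (hg : ContinuousOn g (Ici 0))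
    (hY : ∀ t, 0 ≤ t → Y t = ∫ s in (0 : ℝ)..t, g s) {t : ℝ} (ht : 0 ≤ t) :
    HasDerivWithinAt Y (g t) (Ici 0) t := by
  -- Freezing `g` to the left of `0` makes it continuous everywhere and keeps the integrals.
  have hc : Continuous fun s => g (max s 0) :=
    hg.comp_continuous (continuous_id.max continuous_const) fun s => le_max_right s 0
  have h1 := (hc.integral_hasStrictDerivAt 0 t).hasDerivAt.hasDerivWithinAt (s := Ici 0)
  rw [max_eq_left ht] at h1
  refine h1.congr_of_mem (fun s hs => ?_) ht
  rw [hY s hs]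
  refine intervalIntegral.integral_congr fun u hu => ?_
  rw [uIcc_of_le hs] at hu
  simp only [max_eq_left hu.1]

namespace SwapNetwork.IsScalingSequence

variable {S : ℕ} {N : SwapNetwork S} {Ω : Type*}
  {B F : ℕ → Fin S → ℕ} {Lam : N.graph.edgeSet → ℝ≥0 → Ω → ℕ}
  {V : Fin S → ℝ≥0 → Ω → ℕ} {X : ℕ → Ω → N.Path} {ω : Ω} {rl : ℕ → ℕ} {x : N.Path}

theorem tendsto_scaledPath (hx : N.FluidConverges X ω rl x) (c : N.Comp) {t : ℝ} (ht : 0 ≤ t) :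
    Tendsto (fun l => scaledPath X ω rl c l t) atTop (𝓝 (x c t)) :=
  (hx c t).tendsto_at ⟨ht, le_rfl⟩

theorem lipschitzOnWith_fluid (h : IsScalingSequence N B F Lam V X ω rl)
    (hx : N.FluidConverges X ω rl x) (c : N.Comp) :
    ∃ K : ℝ≥0, LipschitzOnWith K (x c) (Ici 0) :=
  (h.asympLipschitz c).imp fun _ hK =>
    hK.lipschitzOnWith_of_tendsto fun _ ht => tendsto_scaledPath hx c ht

theorem continuousOn_fluid (h : IsScalingSequence N B F Lam V X ω rl)
    (hx : N.FluidConverges X ω rl x) (c : N.Comp) : ContinuousOn (x c) (Ici 0) := by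
  obtain ⟨K, hK⟩ := h.lipschitzOnWith_fluid hx c
  exact hK.continuousOn

/-- If the integrals of the component `d` give the component `c` before the limit, they do so in
the limit, provided that `d` is integrable and its scaled paths are bounded. -/
theorem fluid_eq_integral (hx : N.FluidConverges X ω rl x) {c d : N.Comp} {C : ℝ}
    (heq : ∀ r t, 0 ≤ t → X r ω c t = ∫ s in (0 : ℝ)..t, X r ω d s)
    (hint : ∀ r T, IntegrableOn (X r ω d) (Icc 0 T))
    (hC : ∀ᶠ l in atTop, ∀ t, 0 ≤ t → ‖scaledPath X ω rl d l t‖ ≤ C) {t : ℝ} (ht : 0 ≤ t) :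
    x c t = ∫ s in (0 : ℝ)..t, x d s := by
  have h1 : Tendsto (fun l => ∫ s in (0 : ℝ)..t, scaledPath X ω rl d l s) atTop
      (𝓝 (∫ s in (0 : ℝ)..t, x d s)) := by
    refine intervalIntegral.tendsto_integral_filter_of_dominated_convergence (fun _ => C)
      (Eventually.of_forall fun l => ?_) (hC.mono fun l hl => ?_) intervalIntegrable_const ?_
    · rw [uIoc_of_le ht]
      exact (((hint (rl l) t).mono_set Ioc_subset_Icc_self).div_const _).aestronglyMeasurable
    · refine ae_of_all _ fun s hs => hl s ?_
      rw [uIoc_of_le ht] at hs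
      exact hs.1.le
    · refine ae_of_all _ fun s hs => tendsto_scaledPath hx d ?_
      rw [uIoc_of_le ht] at hs
      exact hs.1.le
  refine tendsto_nhds_unique (tendsto_scaledPath hx c ht) (h1.congr fun l => ?_)
  simp only [scaledPath]
  rw [heq (rl l) t ht, intervalIntegral.integral_div]

theorem fluidEquations (h : IsScalingSequence N B F Lam V X ω rl)
    (hx : N.FluidConverges X ω rl x) : N.FluidEquations x where
  arr_split i j hij t ht := by
    refine tendsto_nhds_unique (tendsto_scaledPath hx _ ht)
      (((tendsto_scaledPath hx (.routed i j hij) ht).add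
        (tendsto_scaledPath hx (.routed j i hij.symm) ht)).congr fun l => ?_)
    rw [scaledPath, scaledPath, scaledPath, (h.path (rl l)).arr_split i j hij t ht, add_div]
  arr_eq e t ht := by
    refine tendsto_nhds_unique (tendsto_scaledPath hx _ ht)
      ((tendsto_time_change (h.fslln_arrivals e) (h.driveTime_mem.mono fun l hl => hl t ht)
        (tendsto_scaledPath hx .driveTime ht)).congr fun l => ?_)
    exact (h.scaledPath_arr e l t ht).symm
  queue_eq j t ht := by
    classical
    refine tendsto_nhds_unique (tendsto_scaledPath hx _ ht)
      ((((tendsto_scaledPath hx (.queue j) le_rfl).add (tendsto_finsetSum _ fun i _ =>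
        tendsto_scaledPath hx (.routed j i.1 i.2) ht)).sub
        (tendsto_scaledPath hx (.compl j) ht)).congr fun l => ?_)
    simp only [scaledPath]
    rw [(h.path (rl l)).queue_eq j t ht, ← Finset.sum_div, ← add_div, ← sub_div]
  compl_eq j t ht := by
    refine tendsto_nhds_unique (tendsto_scaledPath hx _ ht)
      ((tendsto_time_change (h.fslln_services j) ((h.busyTime_mem j).mono fun l hl => hl t ht)
        (tendsto_scaledPath hx (.busyTime j) ht)).congr fun l => ?_)
    exact (h.scaledPath_compl j l t ht).symm
  driveTime_eq t ht := by
    refine fluid_eq_integral hx (C := 1) (fun r => (h.path r).driveTime_eq)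
      (fun r => (h.path r).driving_integrableOn) (h.eventually_pos.mono fun l hl s hs => ?_) ht
    rw [scaledPath, Real.norm_eq_abs,
      abs_of_nonneg (div_nonneg ((h.path _).driving_nonneg hs) hl.le), div_le_one hl]
    exact (h.path _).driving_le hs
  busyTime_eq j t ht := by
    refine fluid_eq_integral hx (C := pointBound N j) (fun r => (h.path r).busyTime_eq j)
      (fun r => (h.path r).busy_integrableOn j) ?_ ht
    filter_upwards [h.eventually_pos, h.eventually_points_le j] with l hl hF s hs
    rw [scaledPath, Real.norm_eq_abs,
      abs_of_nonneg (div_nonneg ((h.path _).busy_nonneg j hs) hl.le), div_le_iff₀ hl]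
    exact ((h.path _).busy_le j hs).trans hF
  busy_eq j t ht := by
    refine tendsto_nhds_unique (tendsto_scaledPath hx _ ht)
      (((tendsto_scaledPath hx (.queue j) ht).min ((h.points j).comp h.tendsto_seq)).congr
        fun l => ?_)
    simp only [scaledPath, Function.comp_apply]
    rw [(h.path (rl l)).busy_eq j t ht, min_div_div_right (Nat.cast_nonneg _)]
  driving_eq t ht := by
    have h1 : Tendsto (fun l => 1 - ∑ j, max (scaledPath X ω rl (.queue j) l t
        - (B (rl l) j : ℝ) / rl l) 0) atTop
        (𝓝 (1 - ∑ j, max (x (.queue j) t - N.effProb j * N.lam / N.mu) 0)) :=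
      tendsto_const_nhds.sub (tendsto_finsetSum _ fun j _ =>
        ((tendsto_scaledPath hx (.queue j) ht).sub ((h.spare j).comp h.tendsto_seq)).max
          tendsto_const_nhds)
    refine tendsto_nhds_unique (tendsto_scaledPath hx _ ht) (h1.congr' ?_)
    filter_upwards [h.eventually_pos] with l hl
    simp only [scaledPath]
    rw [(h.path (rl l)).driving_eq t ht, sub_div, div_self hl.ne', Finset.sum_div]
    refine congrArg _ (Finset.sum_congr rfl fun j _ => ?_)
    rw [← sub_div, ← max_div_div_right hl.le, zero_div]

/-- While station `j` is relatively more loaded than `i` in the fluid limit, it is so in all large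
systems, hence no arrival of the edge `{i, j}` is routed to `j`. -/
theorem eventually_routed_eq (h : IsScalingSequence N B F Lam V X ω rl)
    (hx : N.FluidConverges X ω rl x) {i j : Fin S} (hij : N.graph.Adj i j) {t : ℝ} (ht : 0 ≤ t)
    (hlt : x (.queue i) t / N.effProb i < x (.queue j) t / N.effProb j) :
    ∀ᶠ s in 𝓝[Ici 0] t, x (.routed j i hij.symm) s = x (.routed j i hij.symm) t := by
  -- The load difference exceeds half its value at `t` on a neighbourhood of `t`, which leaves room
  -- for the uniform approximation by the scaled paths.
  set d : ℝ → ℝ := fun u => x (.queue j) u / N.effProb j - x (.queue i) u / N.effProb i with hd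
  have hdc : ContinuousOn d (Ici 0) :=
    ((h.continuousOn_fluid hx _).div_const _).sub ((h.continuousOn_fluid hx _).div_const _)
  have hdt : 0 < d t := sub_pos.2 hlt
  have hu : ∀ T : ℝ, TendstoUniformlyOn (fun l u => scaledPath X ω rl (.queue j) l u / N.effProb j
      - scaledPath X ω rl (.queue i) l u / N.effProb i) d atTop (Icc 0 T) := fun T =>
    have hdiv : ∀ k, TendstoUniformlyOn (fun l u => scaledPath X ω rl (.queue k) l u / N.effProb k)
        (fun u => x (.queue k) u / N.effProb k) atTop (Icc 0 T) := fun k => by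
      simp only [div_eq_inv_mul]
      exact Real.uniformContinuous_const_mul.comp_tendstoUniformlyOn (hx (.queue k) T)
    (hdiv j).sub (hdiv i)
  obtain ⟨δ, hδ, hball⟩ := Metric.mem_nhdsWithin_iff.1
    ((hdc t ht).eventually (lt_mem_nhds (half_lt_self hdt)))
  have hconst : ∀ a b, 0 ≤ a → a < b → a ∈ Metric.ball t δ → b ∈ Metric.ball t δ →
      x (.routed j i hij.symm) b = x (.routed j i hij.symm) a := by
    intro a b ha hab hat hbt
    refine tendsto_nhds_unique (tendsto_scaledPath hx _ (ha.trans hab.le))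
      ((tendsto_scaledPath hx _ ha).congr' ?_)
    filter_upwards [h.eventually_pos,
      Metric.tendstoUniformlyOn_iff.1 (hu b) (d t / 2) (half_pos hdt)] with l hl hul
    rw [scaledPath, scaledPath]
    refine congrArg (· / (rl l : ℝ)) ?_
    refine ((h.path (rl l)).routing j i hij.symm a b ha hab fun u hub => ?_).symm
    have hu0 : 0 ≤ u := ha.trans hub.1
    have hut : u ∈ Metric.ball t δ := by
      rw [Real.ball_eq_Ioo] at hat hbt ⊢
      exact ⟨hat.1.trans_le hub.1, hub.2.trans hbt.2⟩
    have h1 : d t / 2 < d u := hball ⟨hut, hu0⟩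
    have h2 := hul u ⟨hu0, hub.2.le⟩
    rw [Real.dist_eq] at h2
    have h3 := (abs_lt.1 h2).2
    have h4 : 0 < (X (rl l) ω (.queue j) u / N.effProb j
        - X (rl l) ω (.queue i) u / N.effProb i) / rl l := by
      simp only [scaledPath] at h3
      rw [sub_div, div_right_comm, div_right_comm (X (rl l) ω (.queue i) u)]
      linarith
    exact sub_pos.1 ((div_pos_iff_of_pos_right hl).1 h4)
  filter_upwards [inter_mem_nhdsWithin (Ici 0) (Metric.ball_mem_nhds t hδ)] with s hs
  rcases lt_trichotomy s t with hst | hst | hst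
  · exact (hconst s t hs.1 hst hs.2 (Metric.mem_ball_self hδ)).symm
  · rw [hst]
  · exact hconst t s ht hst (Metric.mem_ball_self hδ) hs.2

end SwapNetwork.IsScalingSequence

/-! ### Dynamics and Lyapunov functions of fluid limits -/

/-- A function that is quadratically small at `t` has derivative `0` there. -/
theorem hasDerivWithinAt_zero_of_abs_le_sq {f : ℝ → ℝ} {s : Set ℝ} {t C : ℝ} (ht : t ∈ s)
    (h : ∀ u ∈ s, |f u| ≤ C * (u - t) ^ 2) : HasDerivWithinAt f 0 s t := by
  have ht0 : f t = 0 := by simpa using h t ht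
  refine HasDerivWithinAt.of_isLittleO ?_
  simp only [ht0, smul_zero, sub_zero]
  have h1 : f =O[𝓝[s] t] fun u => (u - t) ^ 2 :=
    Asymptotics.IsBigO.of_bound C (eventually_nhdsWithin_of_forall fun u hu => by
      rw [Real.norm_eq_abs, Real.norm_eq_abs, abs_of_nonneg (sq_nonneg (u - t))]
      exact h u hu)
  refine h1.trans_isLittleO ?_
  have h2 : Tendsto (fun u => u - t) (𝓝[s] t) (𝓝 0) := by
    have : ContinuousWithinAt (fun u => u - t) s t := by fun_prop
    simpa using this.tendsto
  refine (Asymptotics.isLittleO_of_tendsto (fun u hu => by simp [hu]) (h2.congr fun u => ?_))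
  by_cases hu : u - t = 0
  · simp [hu]
  · rw [pow_two, mul_div_assoc, div_self hu, mul_one]

theorem abs_max_zero_sq_sub_le (a b : ℝ) :
    |max b 0 ^ 2 - max a 0 ^ 2 - 2 * max a 0 * (b - a)| ≤ (b - a) ^ 2 := by
  rw [abs_le]
  rcases le_total a 0 with ha | ha <;> rcases le_total b 0 with hb | hb <;>
    simp only [max_eq_left, max_eq_right, ha, hb] <;> constructor <;> nlinarith

theorem abs_min_zero_sq_sub_le (a b : ℝ) :
    |min b 0 ^ 2 - min a 0 ^ 2 - 2 * min a 0 * (b - a)| ≤ (b - a) ^ 2 := by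
  rw [abs_le]
  rcases le_total a 0 with ha | ha <;> rcases le_total b 0 with hb | hb <;>
    simp only [min_eq_left, min_eq_right, ha, hb] <;> constructor <;> nlinarith

namespace SwapNetwork

variable {S : ℕ} {N : SwapNetwork S}

/-- The deterministic properties of a fluid limit that determine its dynamics: it is a Lipschitz
solution of the fluid equations in which a station receives no arrivals of an edge while it is the
relatively more loaded end of that edge. -/
structure IsFluidSolution (N : SwapNetwork S) (x : N.Path) : Prop where
  lipschitz : ∀ c, ∃ K : ℝ≥0, LipschitzOnWith K (x c) (Ici 0)
  equations : N.FluidEquations x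
  routing : ∀ i j (h : N.graph.Adj i j) t, 0 ≤ t →
    x (.queue i) t / N.effProb i < x (.queue j) t / N.effProb j →
    ∀ᶠ s in 𝓝[Ici 0] t, x (.routed j i h.symm) s = x (.routed j i h.symm) t

/-- The sum of `p_{ij} min(w_i, w_j)` over the edges `{i, j}`: the mean weight of the station joined
by an arrival that is always routed to the end of its edge with the lower weight. The sum runs over
ordered pairs and is halved, as each edge is then counted twice. -/
noncomputable def minWeight (N : SwapNetwork S) (w : Fin S → ℝ) : ℝ :=
  (∑ i, ∑ j, N.p s(i, j) * min (w i) (w j)) / 2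

theorem minWeight_nonneg {w : Fin S → ℝ} (hw : ∀ i, 0 ≤ w i) : 0 ≤ N.minWeight w :=
  div_nonneg (Finset.sum_nonneg fun i _ => Finset.sum_nonneg fun j _ =>
    mul_nonneg (N.p_nonneg _) (le_min (hw i) (hw j))) zero_le_two

/-- Routing to the lower-weight end of each edge is at most as costly as splitting the arrivals of
each edge evenly. -/
theorem minWeight_le (w : Fin S → ℝ) : N.minWeight w ≤ ∑ i, N.effProb i * w i := by
  have h1 : ∑ i, ∑ j, N.p s(i, j) * min (w i) (w j)
      ≤ ∑ i, ∑ j, (N.p s(i, j) / 2 * w i + N.p s(j, i) / 2 * w j) := by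
    refine Finset.sum_le_sum fun i _ => Finset.sum_le_sum fun j _ => ?_
    rw [Sym2.eq_swap (a := j)]
    have h2 : min (w i) (w j) ≤ (w i + w j) / 2 := by
      linarith [min_le_left (w i) (w j), min_le_right (w i) (w j)]
    nlinarith [mul_le_mul_of_nonneg_left h2 (N.p_nonneg s(i, j))]
  have h3 : ∑ i, ∑ j, (N.p s(i, j) / 2 * w i + N.p s(j, i) / 2 * w j)
      = 2 * ∑ i, N.effProb i * w i := by
    simp only [Finset.sum_add_distrib]
    rw [Finset.sum_comm (f := fun i j => N.p s(j, i) / 2 * w j)]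
    simp only [← Finset.sum_mul]
    rw [← two_mul]
    rfl
  rw [minWeight, div_le_iff₀ two_pos]
  linarith

theorem minWeight_one : N.minWeight (fun _ => 1) = 1 := by
  have h := sum_sum_sym2_eq_two_mul_sum N.p N.p_diag
  simp only [minWeight, min_self, mul_one]
  rw [h, N.p_sum]
  norm_num

namespace IsFluidSolution

variable {x : N.Path}

theorem continuousOn (hx : N.IsFluidSolution x) (c : N.Comp) : ContinuousOn (x c) (Ici 0) := by
  obtain ⟨K, hK⟩ := hx.lipschitz c
  exact hK.continuousOn

theorem hasDerivWithinAt_arr (hx : N.IsFluidSolution x) (e : N.graph.edgeSet) {t : ℝ}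
    (ht : 0 ≤ t) :
    HasDerivWithinAt (x (.arr e)) (N.p e * N.lam * x .driving t) (Ici 0) t :=
  ((hasDerivWithinAt_Ici_of_eq_integral (hx.continuousOn .driving)
    hx.equations.driveTime_eq ht).const_mul _).congr_of_mem
    (fun s hs => hx.equations.arr_eq e s hs) ht

theorem hasDerivWithinAt_compl (hx : N.IsFluidSolution x) (j : Fin S) {t : ℝ} (ht : 0 ≤ t) :
    HasDerivWithinAt (x (.compl j)) (N.mu * x (.busy j) t) (Ici 0) t :=
  ((hasDerivWithinAt_Ici_of_eq_integral (hx.continuousOn (.busy j))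
    (hx.equations.busyTime_eq j) ht).const_mul _).congr_of_mem
    (fun s hs => hx.equations.compl_eq j s hs) ht

/-- All arrivals of an edge go to its relatively less loaded end. -/
theorem hasDerivWithinAt_routed (hx : N.IsFluidSolution x) {i j : Fin S} (h : N.graph.Adj i j)
    {t : ℝ} (ht : 0 ≤ t)
    (hlt : x (.queue i) t / N.effProb i < x (.queue j) t / N.effProb j) :
    HasDerivWithinAt (x (.routed i j h)) (N.lam * N.p s(i, j) * x .driving t) (Ici 0) t ∧
      HasDerivWithinAt (x (.routed j i h.symm)) 0 (Ici 0) t := by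
  have h0 : HasDerivWithinAt (x (.routed j i h.symm)) 0 (Ici 0) t :=
    (hasDerivWithinAt_const t (Ici 0) (x (.routed j i h.symm) t)).congr_of_eventuallyEq
      (hx.routing i j h t ht hlt) rfl
  refine ⟨?_, h0⟩
  have h1 := ((hx.hasDerivWithinAt_arr ⟨s(i, j), h⟩ ht).sub h0).congr_of_mem
    (f₁ := x (.routed i j h))
    (fun s hs => by rw [Pi.sub_apply, hx.equations.arr_split i j h s hs, add_sub_cancel_right]) ht
  exact h1.congr_deriv (by rw [sub_zero, mul_comm N.lam])

/-- If the weights increase with the relative load, then the weighted arrivals of an edge grow as if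
all of them were routed to the end with the lower weight: this is so if the loads differ, and if
they agree, so do the weights. -/
theorem hasDerivWithinAt_weighted_edge (hx : N.IsFluidSolution x) {w : Fin S → ℝ} {t : ℝ}
    (ht : 0 ≤ t)
    (hw : ∀ i j, x (.queue i) t / N.effProb i ≤ x (.queue j) t / N.effProb j → w i ≤ w j)
    {i j : Fin S} (h : N.graph.Adj i j) :
    HasDerivWithinAt (fun s => w i * x (.routed i j h) s + w j * x (.routed j i h.symm) s)
      (N.p s(i, j) * min (w i) (w j) * (N.lam * x .driving t)) (Ici 0) t := by
  rcases lt_trichotomy (x (.queue i) t / N.effProb i) (x (.queue j) t / N.effProb j)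
    with hlt | heq | hlt
  · obtain ⟨h1, h2⟩ := hx.hasDerivWithinAt_routed h ht hlt
    refine ((h1.const_mul (w i)).add (h2.const_mul (w j))).congr_deriv ?_
    rw [min_eq_left (hw i j hlt.le)]
    ring
  · have hwij : w i = w j := le_antisymm (hw i j heq.le) (hw j i heq.ge)
    have h1 := ((hx.hasDerivWithinAt_arr ⟨s(i, j), h⟩ ht).const_mul (w j)).congr_of_mem
      (f₁ := fun s => w i * x (.routed i j h) s + w j * x (.routed j i h.symm) s)
      (fun s hs => by rw [hx.equations.arr_split i j h s hs, hwij]; ring) ht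
    refine h1.congr_deriv ?_
    rw [hwij, min_self]
    ring
  · obtain ⟨h1, h2⟩ := hx.hasDerivWithinAt_routed h.symm ht hlt
    refine ((h2.const_mul (w i)).add (h1.const_mul (w j))).congr_deriv ?_
    rw [min_eq_right (hw j i hlt.le), Sym2.eq_swap]
    ring

theorem hasDerivWithinAt_weighted_queue (hx : N.IsFluidSolution x) {w : Fin S → ℝ} {t : ℝ}
    (ht : 0 ≤ t)
    (hw : ∀ i j, x (.queue i) t / N.effProb i ≤ x (.queue j) t / N.effProb j → w i ≤ w j) :
    HasDerivWithinAt (fun s => ∑ j, w j * x (.queue j) s)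
      (N.lam * x .driving t * N.minWeight w - ∑ j, w j * (N.mu * x (.busy j) t)) (Ici 0) t := by
  classical
  set R : Fin S → Fin S → ℝ → ℝ := fun i j s =>
    if h : N.graph.Adj i j then x (.routed i j h) s else 0 with hR
  have hpair : ∀ i j, HasDerivWithinAt (fun s => w i * R i j s + w j * R j i s)
      (N.p s(i, j) * min (w i) (w j) * (N.lam * x .driving t)) (Ici 0) t := by
    intro i j
    by_cases h : N.graph.Adj i j
    · simp only [hR, dif_pos h, dif_pos h.symm]
      exact hx.hasDerivWithinAt_weighted_edge ht hw h
    · have h' : ¬ N.graph.Adj j i := fun hji => h hji.symm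
      have hp : N.p s(i, j) = 0 := le_antisymm (not_lt.1 h) (N.p_nonneg _)
      simp only [hR, dif_neg h, dif_neg h', hp, mul_zero, add_zero, zero_mul]
      exact hasDerivWithinAt_const _ _ _
  have hsum : HasDerivWithinAt (fun s => (∑ i, ∑ j, (w i * R i j s + w j * R j i s)) / 2)
      (N.lam * x .driving t * N.minWeight w) (Ici 0) t := by
    have h1 := (HasDerivWithinAt.fun_sum (u := Finset.univ) fun i _ =>
      HasDerivWithinAt.fun_sum (u := Finset.univ) fun j _ => hpair i j).div_const 2
    refine h1.congr_deriv ?_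
    simp only [← Finset.sum_mul, minWeight]
    ring
  have hcompl : HasDerivWithinAt (fun s => ∑ j, w j * x (.compl j) s)
      (∑ j, w j * (N.mu * x (.busy j) t)) (Ici 0) t :=
    HasDerivWithinAt.fun_sum fun j _ => (hx.hasDerivWithinAt_compl j ht).const_mul (w j)
  refine ((hsum.const_add (∑ j, w j * x (.queue j) 0)).sub hcompl).congr_of_mem
    (fun s hs => ?_) ht
  have hq : ∀ j, x (.queue j) s = x (.queue j) 0 + ∑ i, R j i s - x (.compl j) s := by
    intro j
    rw [hx.equations.queue_eq j s hs]
    rw [N.sum_neighborSet_eq j fun i h => x (.routed j i h) s]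
  have hswap : ∑ i, ∑ j, (w i * R i j s + w j * R j i s) = 2 * ∑ j, w j * ∑ i, R j i s := by
    simp only [Finset.sum_add_distrib]
    rw [Finset.sum_comm (f := fun i j => w j * R j i s), ← two_mul]
    simp only [Finset.mul_sum]
  simp only [Pi.sub_apply]
  rw [hswap, mul_div_cancel_left₀ _ two_ne_zero, ← Finset.sum_add_distrib,
    ← Finset.sum_sub_distrib]
  refine Finset.sum_congr rfl fun j _ => ?_
  rw [hq j]
  ring

/-- A weighted sum of a function `f` with Lipschitz derivative `2 g` of the relative loads can be
differentiated although the individual queue lengths need not be differentiable, because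
its linear part is a weighted sum of queue lengths with weights increasing in the load. -/
theorem hasDerivWithinAt_lyapunov (hx : N.IsFluidSolution x) (hp : ∀ i, 0 < N.effProb i)
    {f g : ℝ → ℝ} (hg : Monotone g)
    (hfg : ∀ a b, |f b - f a - 2 * g a * (b - a)| ≤ (b - a) ^ 2) {t : ℝ} (ht : 0 ≤ t) :
    HasDerivWithinAt (fun s => ∑ j, N.effProb j * f (x (.queue j) s / N.effProb j))
      (2 * (N.lam * x .driving t * N.minWeight (fun j => g (x (.queue j) t / N.effProb j))
        - ∑ j, g (x (.queue j) t / N.effProb j) * (N.mu * x (.busy j) t))) (Ici 0) t := by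
  set w : Fin S → ℝ := fun j => g (x (.queue j) t / N.effProb j) with hwdef
  have hlin := (hx.hasDerivWithinAt_weighted_queue (w := w) ht fun i j hij => hg hij).const_mul 2
  have hrem : ∀ j, HasDerivWithinAt (fun s => N.effProb j * (f (x (.queue j) s / N.effProb j)
      - f (x (.queue j) t / N.effProb j)
      - 2 * w j * (x (.queue j) s / N.effProb j - x (.queue j) t / N.effProb j))) 0 (Ici 0) t := by
    intro j
    obtain ⟨K, hK⟩ := hx.lipschitz (.queue j)
    refine hasDerivWithinAt_zero_of_abs_le_sq (C := K ^ 2 / N.effProb j) ht fun u hu => ?_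
    have h1 := hK.dist_le_mul u hu t ht
    rw [Real.dist_eq, Real.dist_eq] at h1
    have h2 : (x (.queue j) u - x (.queue j) t) ^ 2 ≤ K ^ 2 * (u - t) ^ 2 := by
      rw [← sq_abs, ← sq_abs (u - t), ← mul_pow]
      exact pow_le_pow_left₀ (abs_nonneg _) h1 2
    have h3 := hfg (x (.queue j) t / N.effProb j) (x (.queue j) u / N.effProb j)
    rw [abs_mul, abs_of_pos (hp j)]
    refine (mul_le_mul_of_nonneg_left h3 (hp j).le).trans ?_
    have h4 : N.effProb j * (x (.queue j) u / N.effProb j - x (.queue j) t / N.effProb j) ^ 2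
        = (x (.queue j) u - x (.queue j) t) ^ 2 / N.effProb j := by
      have := (hp j).ne'
      field_simp
    rw [h4, div_mul_eq_mul_div]
    exact div_le_div_of_nonneg_right h2 (hp j).le
  have hall := (hlin.add (HasDerivWithinAt.fun_sum (u := Finset.univ) fun j _ => hrem j)).const_add
    (∑ j, (N.effProb j * f (x (.queue j) t / N.effProb j) - 2 * (w j * x (.queue j) t)))
  rw [Finset.sum_const_zero, add_zero] at hall
  refine hall.congr_of_mem (fun s _ => ?_) ht
  simp only [Pi.add_apply]
  rw [Finset.mul_sum, ← Finset.sum_add_distrib, ← Finset.sum_add_distrib]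
  refine Finset.sum_congr rfl fun j _ => ?_
  have := (hp j).ne'
  field_simp
  ring

/-- A Lyapunov function with nonpositive derivative that starts at `0` stays at `0`. -/
theorem lyapunov_eq_zero (hx : N.IsFluidSolution x) (hp : ∀ i, 0 < N.effProb i)
    {f g : ℝ → ℝ} (hg : Monotone g)
    (hfg : ∀ a b, |f b - f a - 2 * g a * (b - a)| ≤ (b - a) ^ 2) (hf : ∀ a, 0 ≤ f a)
    (h0 : ∀ j, f (x (.queue j) 0 / N.effProb j) = 0)
    (hle : ∀ t, 0 ≤ t →
      N.lam * x .driving t * N.minWeight (fun j => g (x (.queue j) t / N.effProb j))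
        ≤ ∑ j, g (x (.queue j) t / N.effProb j) * (N.mu * x (.busy j) t))
    {t : ℝ} (ht : 0 ≤ t) (j : Fin S) : f (x (.queue j) t / N.effProb j) = 0 := by
  set G : ℝ → ℝ := fun s => ∑ j, N.effProb j * f (x (.queue j) s / N.effProb j) with hG
  have hd : ∀ s, 0 ≤ s → HasDerivWithinAt G _ (Ici 0) s := fun s hs =>
    hx.hasDerivWithinAt_lyapunov hp hg hfg hs
  have hanti : AntitoneOn G (Ici 0) := by
    refine antitoneOn_of_hasDerivWithinAt_nonpos (convex_Ici 0)
      (fun s hs => (hd s hs).continuousWithinAt)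
      (fun s hs => (hd s (interior_subset hs)).mono interior_subset) fun s hs => ?_
    linarith [hle s (interior_subset hs)]
  have hterm : ∀ k ∈ Finset.univ, 0 ≤ N.effProb k * f (x (.queue k) t / N.effProb k) :=
    fun k _ => mul_nonneg (hp k).le (hf _)
  have h1 : G t ≤ G 0 := hanti (mem_Ici.2 le_rfl) ht ht
  have h2 : G 0 = 0 := Finset.sum_eq_zero fun k _ => by rw [h0, mul_zero]
  have h3 : G t = 0 := le_antisymm (h1.trans_eq h2) (Finset.sum_nonneg hterm)
  have h4 := (Finset.sum_eq_zero_iff_of_nonneg hterm).1 h3 j (Finset.mem_univ j)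
  exact (mul_eq_zero.1 h4).resolve_left (hp j).ne'

theorem driving_le_one (hx : N.IsFluidSolution x) {t : ℝ} (ht : 0 ≤ t) : x .driving t ≤ 1 := by
  rw [hx.equations.driving_eq t ht]
  linarith [Finset.sum_nonneg fun j (_ : j ∈ Finset.univ) =>
    le_max_right (x (.queue j) t - N.effProb j * N.lam / N.mu) 0]

theorem driving_eq_one (hx : N.IsFluidSolution x) {t : ℝ} (ht : 0 ≤ t)
    (hq : ∀ j, x (.queue j) t ≤ N.effProb j * N.lam / N.mu) : x .driving t = 1 := by
  rw [hx.equations.driving_eq t ht, Finset.sum_eq_zero fun j _ => ?_, sub_zero]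
  exact max_eq_right (sub_nonpos.2 (hq j))

/-- The weighted departure rate for the excess load: an overloaded station works at capacity. -/
theorem sum_excess_busy (hx : N.IsFluidSolution x) (hp : ∀ i, 0 < N.effProb i) {t : ℝ}
    (ht : 0 ≤ t) :
    ∑ j, max (x (.queue j) t / N.effProb j - N.lam / N.mu) 0 * (N.mu * x (.busy j) t)
      = N.lam * ∑ j, N.effProb j * max (x (.queue j) t / N.effProb j - N.lam / N.mu) 0 := by
  rw [Finset.mul_sum]
  refine Finset.sum_congr rfl fun j _ => ?_
  rcases le_total (x (.queue j) t / N.effProb j - N.lam / N.mu) 0 with h | h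
  · simp [max_eq_right h]
  · have h1 : N.effProb j * N.lam / N.mu ≤ x (.queue j) t := by
      rw [sub_nonneg, le_div_iff₀ (hp j)] at h
      rwa [mul_div_assoc, mul_comm]
    rw [hx.equations.busy_eq j t ht, min_eq_right h1, mul_div_cancel₀ _ N.mu_pos.ne']
    ring

theorem queue_eq_of_queue_zero_eq (hx : N.IsFluidSolution x) (hp : ∀ i, 0 < N.effProb i)
    (h0 : ∀ j, x (.queue j) 0 = N.effProb j * N.lam / N.mu) {t : ℝ} (ht : 0 ≤ t) (j : Fin S) :
    x (.queue j) t = N.effProb j * N.lam / N.mu := by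
  set ρ := N.lam / N.mu with hρ
  have hz : ∀ j, x (.queue j) 0 / N.effProb j - ρ = 0 := fun j => by
    have := (hp j).ne'
    rw [h0, hρ]
    field_simp
    ring
  have hle : ∀ j t, x (.queue j) t / N.effProb j - ρ ≤ 0 ↔
      x (.queue j) t ≤ N.effProb j * N.lam / N.mu := fun j t => by
    rw [sub_nonpos, div_le_iff₀ (hp j), hρ, mul_div_assoc, mul_comm]
  -- The excess load cannot grow.
  have hup : ∀ t, 0 ≤ t → ∀ j, x (.queue j) t ≤ N.effProb j * N.lam / N.mu := by
    intro t ht j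
    have h1 := hx.lyapunov_eq_zero hp (f := fun a => max (a - ρ) 0 ^ 2)
      (g := fun a => max (a - ρ) 0)
      (fun a b hab => max_le_max_right 0 (sub_le_sub_right hab ρ))
      (fun a b => by simpa using abs_max_zero_sq_sub_le (a - ρ) (b - ρ))
      (fun a => sq_nonneg _) (fun j => by simp [hz j]) (fun t ht => ?_) ht j
    · rw [← hle, ← max_eq_right_iff]
      exact pow_eq_zero_iff two_ne_zero |>.1 h1
    · rw [hx.sum_excess_busy hp ht, mul_assoc]
      refine mul_le_mul_of_nonneg_left ?_ N.lam_pos.le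
      refine (mul_le_of_le_one_left (minWeight_nonneg fun j => le_max_right _ _)
        (hx.driving_le_one ht)).trans (minWeight_le _)
  -- Hence all cars keep driving, and the load deficit cannot grow either.
  have h2 := hx.lyapunov_eq_zero hp (f := fun a => min (a - ρ) 0 ^ 2)
    (g := fun a => min (a - ρ) 0)
    (fun a b hab => min_le_min_right 0 (sub_le_sub_right hab ρ))
    (fun a b => by simpa using abs_min_zero_sq_sub_le (a - ρ) (b - ρ))
    (fun a => sq_nonneg _) (fun j => by simp [hz j]) (fun t ht => ?_) ht j
  · have h3 : 0 ≤ x (.queue j) t / N.effProb j - ρ := by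
      rw [← min_eq_right_iff]
      exact pow_eq_zero_iff two_ne_zero |>.1 h2
    refine le_antisymm (hup t ht j) ?_
    rw [sub_nonneg, le_div_iff₀ (hp j)] at h3
    rwa [mul_div_assoc, mul_comm]
  · rw [hx.driving_eq_one ht (hup t ht), mul_one]
    refine (mul_le_mul_of_nonneg_left (minWeight_le _) N.lam_pos.le).trans ?_
    rw [Finset.mul_sum]
    refine Finset.sum_le_sum fun k _ => ?_
    rw [hx.equations.busy_eq k t ht, min_eq_left (hup t ht k), ← mul_assoc, mul_comm]
    refine mul_le_mul_of_nonpos_left ?_ (min_le_right _ _)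
    have h4 := hup t ht k
    rw [le_div_iff₀ N.mu_pos] at h4
    linarith

/-- The only constant queue lengths of a fluid solution are those at which all charging points are
exactly used. -/
theorem eq_of_queue_const (hx : N.IsFluidSolution x) (hp : ∀ i, 0 < N.effProb i)
    {q : Fin S → ℝ} (hq : ∀ t, 0 ≤ t → ∀ j, x (.queue j) t = q j) (j : Fin S) :
    q j = N.effProb j * N.lam / N.mu := by
  have hq0 := hq 0 le_rfl
  -- Any increasing weighting of the constant queue lengths balances arrivals and departures.
  have hbal : ∀ g : ℝ → ℝ, Monotone g →
      N.lam * x .driving 0 * N.minWeight (fun j => g (x (.queue j) 0 / N.effProb j))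
        = ∑ j, g (x (.queue j) 0 / N.effProb j) * (N.mu * x (.busy j) 0) := by
    intro g hg
    have h1 := hx.hasDerivWithinAt_weighted_queue
      (w := fun j => g (x (.queue j) 0 / N.effProb j)) le_rfl fun i j hij => hg hij
    have h2 := (hasDerivWithinAt_const (0 : ℝ) (Ici 0)
      (∑ j, g (x (.queue j) 0 / N.effProb j) * q j)).congr_of_mem
      (f₁ := fun s => ∑ j, g (x (.queue j) 0 / N.effProb j) * x (.queue j) s)
      (fun s hs => Finset.sum_congr rfl fun j _ => by rw [hq s hs j]) (mem_Ici.2 le_rfl)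
    exact sub_eq_zero.1 ((uniqueDiffOn_Ici (0 : ℝ) 0 (mem_Ici.2 le_rfl)).eq_deriv _ h1 h2)
  have hL := hx.equations.driving_eq 0 le_rfl
  set w : Fin S → ℝ := fun j => max (x (.queue j) 0 / N.effProb j - N.lam / N.mu) 0 with hw
  have hwmax : ∀ j, max (x (.queue j) 0 - N.effProb j * N.lam / N.mu) 0 = N.effProb j * w j := by
    intro j
    rw [hw, mul_max_of_nonneg _ _ (hp j).le, mul_zero, mul_sub, mul_div_cancel₀ _ (hp j).ne',
      mul_div_assoc]
  simp only [hwmax] at hL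
  have hw0 : ∀ j ∈ Finset.univ, 0 ≤ N.effProb j * w j := fun j _ =>
    mul_nonneg (hp j).le (le_max_right _ _)
  -- An excess load would make the weighted departures outweigh the weighted arrivals.
  have hs : ∑ j, N.effProb j * w j = 0 := by
    have h1 := hbal (fun a => max (a - N.lam / N.mu) 0)
      fun a b hab => max_le_max_right 0 (sub_le_sub_right hab _)
    rw [hx.sum_excess_busy hp le_rfl, mul_assoc] at h1
    have h2 : x .driving 0 * N.minWeight w = ∑ j, N.effProb j * w j :=
      mul_left_cancel₀ N.lam_pos.ne' h1
    have h3 := N.minWeight_le w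
    have h4 : 0 ≤ N.minWeight w := minWeight_nonneg fun j => le_max_right _ _
    rw [hL] at h2
    have h5 := Finset.sum_nonneg hw0
    have h6 := mul_nonneg h5 h4
    have h7 : N.minWeight w = ∑ j, N.effProb j * w j := le_antisymm h3 (by linarith)
    rw [h7] at h2
    exact mul_self_eq_zero.1 (by linarith)
  have hle : ∀ j, x (.queue j) 0 ≤ N.effProb j * N.lam / N.mu := fun j => by
    have h1 := (Finset.sum_eq_zero_iff_of_nonneg hw0).1 hs j (Finset.mem_univ j)
    rw [← hwmax j, max_eq_right_iff] at h1
    linarith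
  have h1 := hbal (fun _ => 1) monotone_const
  rw [minWeight_one, hx.driving_eq_one le_rfl hle] at h1
  have h2 : ∑ j, x (.queue j) 0 = ∑ j, N.effProb j * N.lam / N.mu := by
    simp only [hx.equations.busy_eq _ 0 le_rfl, min_eq_left (hle _), one_mul, mul_one,
      ← Finset.mul_sum] at h1
    rw [← Finset.sum_div, ← Finset.sum_mul, sum_effProb, eq_div_iff N.mu_pos.ne']
    linarith
  rw [← hq0 j]
  exact (Finset.sum_eq_sum_iff_of_le fun j _ => hle j).1 h2 j (Finset.mem_univ j)

end IsFluidSolution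

variable {Ω : Type*} {B F : ℕ → Fin S → ℕ} {Lam : N.graph.edgeSet → ℝ≥0 → Ω → ℕ}
  {V : Fin S → ℝ≥0 → Ω → ℕ} {X : ℕ → Ω → N.Path}

theorem IsScalingSequence.isFluidSolution {ω : Ω} {rl : ℕ → ℕ} {x : N.Path}
    (h : IsScalingSequence N B F Lam V X ω rl)
    (hx : N.FluidConverges X ω rl x) : N.IsFluidSolution x where
  lipschitz := h.lipschitzOnWith_fluid hx
  equations := h.fluidEquations hx
  routing _ _ hij _ := h.eventually_routed_eq hx hij

end SwapNetwork

theorem mainTheorem3 {S : ℕ} (N : SwapNetwork S) (hconn : N.graph.Connected)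
    {Ω : Type*} [MeasurableSpace Ω] (P : Measure Ω) [IsProbabilityMeasure P]
    (Lam : N.graph.edgeSet → ℝ≥0 → Ω → ℕ) (V : Fin S → ℝ≥0 → Ω → ℕ)
    (hprim : N.IsPrimitive P Lam V)
    (B F : ℕ → Fin S → ℕ)
    (hB : N.IsRoundedCapacity N.beta B) (hF : N.IsRoundedCapacity N.gamma F)
    (X : ℕ → Ω → N.Path) (hX : N.IsSystemSequence B F Lam V X) :
    -- fluid limits exist: the functional law of large numbers holds almost surely, and wherever it
    -- holds, each subsequence of the scaled paths has a further subsequence that converges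
    (∀ᵐ ω ∂P, ω ∈ N.fsllnSet Lam V) ∧
    (∀ ω ∈ N.fsllnSet Lam V, ∀ rl : ℕ → ℕ, Tendsto rl atTop atTop →
      ∃ φ : ℕ → ℕ, StrictMono φ ∧ ∃ x : N.Path, N.FluidConverges X ω (rl ∘ φ) x) ∧
    (∃ x : N.Path, N.IsFluidLimit Lam V X x) ∧
    -- properties of each fluid limit
    (∀ x : N.Path, N.IsFluidLimit Lam V X x →
      (∀ c, ∃ K : ℝ≥0, LipschitzOnWith K (x c) (Ici 0)) ∧
      N.FluidEquations x ∧
      (∀ i j (h : N.graph.Adj i j) t, N.IsRegularPoint x t →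
        x (.queue i) t / N.effProb i < x (.queue j) t / N.effProb j →
        HasDerivWithinAt (x (.routed i j h)) (N.lam * N.p s(i, j) * x .driving t) (Ici 0) t ∧
        HasDerivWithinAt (x (.routed j i h.symm)) 0 (Ici 0) t)) ∧
    -- the invariant state, and its uniqueness among the initial states of fluid limits
    N.IsInvariantState Lam V X (fun i => N.effProb i * N.lam / N.mu) ∧
    (∀ q : Fin S → ℝ, (∃ x, N.IsFluidLimit Lam V X x ∧ ∀ i, x (.queue i) 0 = q i) →
      N.IsInvariantState Lam V X q → q = fun i => N.effProb i * N.lam / N.mu) := by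
  have hp := N.effProb_pos hconn
  have hseq : ∀ ω ∈ N.fsllnSet Lam V, ∀ rl : ℕ → ℕ, Tendsto rl atTop atTop →
      SwapNetwork.IsScalingSequence N B F Lam V X ω rl := fun ω hω rl hrl =>
    { path := fun r => hX.path r ω
      fslln := hω
      tendsto_seq := hrl
      spare := SwapNetwork.IsRoundedCapacity.tendsto_div N hB
      points := SwapNetwork.IsRoundedCapacity.tendsto_div N hF }
  have hsol : ∀ x, N.IsFluidLimit Lam V X x → N.IsFluidSolution x := by
    rintro x ⟨ω, hω, rl, hrl, hx⟩
    exact (hseq ω hω rl hrl).isFluidSolution hx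
  have hae := N.ae_mem_fsllnSet hprim
  refine ⟨hae, fun ω hω rl hrl => (hseq ω hω rl hrl).exists_subseq_fluidConverges, ?_,
    fun x hx => ⟨(hsol x hx).lipschitz, (hsol x hx).equations, fun i j h t ht hlt =>
      (hsol x hx).hasDerivWithinAt_routed h ht.1 hlt⟩,
    fun x hx h0 t ht i => (hsol x hx).queue_eq_of_queue_zero_eq hp h0 ht i, ?_⟩
  · obtain ⟨ω, hω⟩ := hae.exists
    obtain ⟨φ, hφ, x, hx⟩ := (hseq ω hω id tendsto_id).exists_subseq_fluidConverges
    exact ⟨x, ω, hω, id ∘ φ, hφ.tendsto_atTop, hx⟩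
  · rintro q ⟨x, hx, h0⟩ hinv
    exact funext fun j => (hsol x hx).eq_of_queue_const hp (hinv x hx h0) j
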